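/- Let $k$ be an algebraically closed field of characteristic $p>0$, let $V$ be a finite-dimensional $k$-vector space, and let $G\subset\operatorname{GL}(V)$ be a finite subgroup whose order is not divisible by $p$ and which contains no pseudo-reflections (elements $g$ for which $g-1$ has rank one). Let $S=\operatorname{Sym}_k V$ with the induced action of $G$ by $k$-algebra automorphisms, graded with $V$ in degree $1$, let $\mathfrak m\subset S$ be the ideal generated by $V$, and let $R=S^G$ with the induced grading. Let $V_0=k,V_1,\dots,V_n$ be a complete set of pairwise non-isomorphic irreducible representations of $G$ over $k$, with $V_0$ trivial, and put $M_i=(S\otimes_kV_i)^G$, where $G$ acts diagonally on $S\otimes_k V_i$. A $(G,S)$-module is an $S$-module with a $k$-linear action of $G$ such that $g(sx)=(gs)(gx)$; isomorphisms of $(G,S)$-modules are the $G$-equivariant $S$-linear bijections. Fix $e\ge 1$ and put $q=p^e$. For a module $M$ over a commutative ring $A$ of characteristic $p$, ${}^eM$ denotes the additive group $M$, with elements written ${}^ex$, and with scalar multiplication $a\cdot{}^ex={}^e(a^{q}x)$ for $a\in A$. The group $G$ acts on ${}^eS$ by $g\cdot{}^ex={}^e(gx)$. The modules ${}^eS$ and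 ${}^eR$ are $\frac1q\mathbb Z$-graded by $({}^eM)_t={}^e(M_{qt})$; the modules $S\otimes_kV_i$ are graded with $V_i$ in degree $0$, the modules $M_i$ carry the induced grading, and $M(-\alpha)_t=M_{t-\alpha}$. Let $c_{0,e},\dots,c_{n,e}\ge 0$ be integers. Then the following are equivalent: 1. ${}^eR\cong\bigoplus_{i=0}^n M_i^{\oplus c_{i,e}}$ as $R$-modules; 2. ${}^eS\cong\bigoplus_{i=0}^n (S\otimes_kV_i)^{\oplus c_{i,e}}$ as $(G,S)$-modules; 3. ${}^eS/\mathfrak m\,{}^eS\cong\bigoplus_{i=0}^n V_i^{\oplus c_{i,e}}$ as $G$-modules, that is, as $k$-linear representations of $G$; 4. there exist $\alpha_{ij}\in\frac1q\mathbb Z_{\ge0}$ such that ${}^eS\cong\bigoplus_{i=0}^n\bigoplus_{j=1}^{c_{i,e}}(S\otimes_kV_i)(-\alpha_{ij})$ as $\frac1q\mathbb Z$-graded $(G,S)$-modules; 5. there exist $\alpha_{ij}\in\frac1q\mathbb Z_{\ge0}$ such that ${}^eR\cong\bigoplus_{i=0}^n\bigoplus_{j=1}^{c_{i,e}}M_i(-\alpha_{ij})$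 as $\frac1q\mathbb Z$-graded $R$-modules. -/

import Mathlib

open scoped TensorProduct DirectSum

universe w

noncomputable section

/-! ### Frobenius twists -/

/-- `{}^e M`: the same additive group as `M`, with scalars acting through the `e`-fold iterated
Frobenius, `a • x = a ^ (p ^ e) x`. -/
def FrobTwist (_p _e : ℕ) (M : Type*) : Type _ := M

namespace FrobTwist

variable {p e : ℕ} {M : Type*}

instance [AddCommGroup M] : AddCommGroup (FrobTwist p e M) := inferInstanceAs (AddCommGroup M)

/-- The identity map `M → {}^e M`, `x ↦ {}^e x`. -/
def of (p e : ℕ) (M : Type*) [AddCommGroup M] : M ≃+ FrobTwist p e M := AddEquiv.refl M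

instance instModule (A : Type*) [CommRing A] [ExpChar A p] [AddCommGroup M] [Module A M] :
    Module A (FrobTwist p e M) :=
  Module.compHom M (iterateFrobenius A p e)

theorem smul_of (A : Type*) [CommRing A] [ExpChar A p] [AddCommGroup M] [Module A M]
    (a : A) (x : M) : a • of p e M x = of p e M (a ^ (p ^ e) • x) := rfl

instance (k A : Type*) [CommRing k] [CommRing A] [Algebra k A] [ExpChar k p] [ExpChar A p]
    [AddCommGroup M] [Module k M] [Module A M] [IsScalarTower k A M] :
    IsScalarTower k A (FrobTwist p e M) where
  smul_assoc a s x := by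
    obtain ⟨x, rfl⟩ := (of p e M).surjective x
    rw [smul_of, smul_of, smul_of, smul_pow, smul_assoc]

/-- The Frobenius twist of a representation: `g ({}^e x) = {}^e (g x)`. -/
def rep (p e : ℕ) {k Γ : Type*} [CommRing k] [ExpChar k p] [Monoid Γ] [AddCommGroup M] [Module k M]
    (ρ : Representation k Γ M) : Representation k Γ (FrobTwist p e M) where
  toFun g :=
    { toFun := fun x => of p e M (ρ g ((of p e M).symm x))
      map_add' := fun x y => by simp
      map_smul' := fun a x => by
        obtain ⟨x, rfl⟩ := (of p e M).surjective x
        simp [smul_of] }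
  map_one' := by ext x; simp
  map_mul' g h := by ext x; simp

@[simp] theorem rep_of {k Γ : Type*} [CommRing k] [ExpChar k p] [Monoid Γ] [AddCommGroup M]
    [Module k M] (ρ : Representation k Γ M) (g : Γ) (x : M) :
    rep p e ρ g (of p e M x) = of p e M (ρ g x) := rfl

end FrobTwist

/-! ### The group, the polynomial ring `S = Sym V` and the invariant ring `R = S ^ G` -/

/-- `g` is a pseudo-reflection: the image of `g - 1` is a line, equivalently (`V` being
finite-dimensional) the fixed space of `g` is a hyperplane. -/
def IsPseudoReflection {k V : Type*} [Field k] [AddCommGroup V] [Module k V]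
    (g : LinearMap.GeneralLinearGroup k V) : Prop :=
  Module.finrank k (LinearMap.range ((g : V →ₗ[k] V) - 1)) = 1

section Invariants

variable {k V : Type*} [Field k] [AddCommGroup V] [Module k V]

instance (p : ℕ) [ExpChar k p] : ExpChar (SymmetricAlgebra k V) p :=
  expChar_of_injective_algebraMap (SymmetricAlgebra.algebraMap_leftInverse V).injective p

variable (G : Subgroup (LinearMap.GeneralLinearGroup k V))

/-- The action of `G` on `S = Sym V` by `k`-algebra endomorphisms extending the action on `V`. -/
def symAct : G →* (SymmetricAlgebra k V →ₐ[k] SymmetricAlgebra k V) where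
  toFun g := SymmetricAlgebra.lift
    (SymmetricAlgebra.ι k V ∘ₗ ((g : LinearMap.GeneralLinearGroup k V) : V →ₗ[k] V))
  map_one' := by
    apply SymmetricAlgebra.algHom_ext
    ext v
    simp
  map_mul' g h := by
    apply SymmetricAlgebra.algHom_ext
    ext v
    simp

/-- `S = Sym V` as a `k`-linear representation of `G`. -/
def symRep : Representation k G (SymmetricAlgebra k V) where
  toFun g := (symAct G g).toLinearMap
  map_one' := by ext x; simp
  map_mul' g h := by ext x; simp

@[simp] theorem symRep_apply (g : G) (s : SymmetricAlgebra k V) :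
    symRep G g s = symAct G g s := rfl

/-- The invariant ring `R = S ^ G`. -/
def invariantRing : Subalgebra k (SymmetricAlgebra k V) where
  carrier := {s | ∀ g : G, symAct G g s = s}
  mul_mem' ha hb g := by rw [map_mul, ha g, hb g]
  add_mem' ha hb g := by rw [map_add, ha g, hb g]
  algebraMap_mem' a g := (symAct G g).commutes a

instance (p : ℕ) [ExpChar k p] : ExpChar (invariantRing G) p :=
  expChar_of_injective_algebraMap (FaithfulSMul.algebraMap_injective k (invariantRing G)) p

/-! ### `(G, S)`-modules -/

/-- An `S`-module `M` with a `k`-linear action `ρ` of `G` is a `(G, S)`-module if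
`g (s x) = (g s) (g x)`. -/
def IsGSModule {M : Type*} [AddCommMonoid M] [Module k M] [Module (SymmetricAlgebra k V) M]
    (ρ : Representation k G M) : Prop :=
  ∀ (g : G) (s : SymmetricAlgebra k V) (x : M), ρ g (s • x) = symAct G g s • ρ g x

/-- `{}^e S` as a representation of `G`. -/
abbrev frobSymRep (p e : ℕ) [ExpChar k p] :
    Representation k G (FrobTwist p e (SymmetricAlgebra k V)) :=
  FrobTwist.rep p e (symRep G)

theorem isGSModule_frobSymRep (p e : ℕ) [ExpChar k p] : IsGSModule G (frobSymRep G p e) := by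
  intro g s x
  obtain ⟨x, rfl⟩ := (FrobTwist.of p e _).surjective x
  simp [FrobTwist.smul_of]

variable {W : Type*} [AddCommGroup W] [Module k W] (ρ : Representation k G W)

/-- `S ⊗ W` with the diagonal action `g (s ⊗ w) = g s ⊗ g w`. -/
abbrev symTensorRep : Representation k G (SymmetricAlgebra k V ⊗[k] W) := (symRep G).tprod ρ

theorem isGSModule_symTensorRep : IsGSModule G (symTensorRep G ρ) := by
  intro g s x
  induction x with
  | zero => simp
  | add x y hx hy => simp only [smul_add, map_add, hx, hy]
  | tmul t w => simp [TensorProduct.smul_tmul']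

/-- The `R`-module of covariants `(S ⊗ W) ^ G`. -/
def covariants : Submodule (invariantRing G) (SymmetricAlgebra k V ⊗[k] W) where
  carrier := {x | ∀ g : G, symTensorRep G ρ g x = x}
  add_mem' ha hb g := by rw [map_add, ha g, hb g]
  zero_mem' g := map_zero _
  smul_mem' r x hx g := by
    have h := isGSModule_symTensorRep G ρ g (r : SymmetricAlgebra k V) x
    rw [hx g, r.2 g] at h
    exact h

/-- An isomorphism of `(G, S)`-modules: an `S`-linear bijection commuting with `G`. -/
structure GSEquiv {M N : Type*} [AddCommMonoid M] [Module k M] [Module (SymmetricAlgebra k V) M]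
    [AddCommMonoid N] [Module k N] [Module (SymmetricAlgebra k V) N]
    (σ : Representation k G M) (τ : Representation k G N)
    extends M ≃ₗ[SymmetricAlgebra k V] N where
  map_rep : ∀ (g : G) (x : M), toFun (σ g x) = τ g (toFun x)

/-! ### The fibre `{}^e S / 𝔪 {}^e S` -/

variable (k V) in
/-- The homogeneous maximal ideal `𝔪` of `S`, generated by `V`. -/
def symMaxIdeal : Ideal (SymmetricAlgebra k V) :=
  Ideal.span (Set.range (SymmetricAlgebra.ι k V))

theorem symAct_mem_symMaxIdeal (g : G) {s : SymmetricAlgebra k V} (hs : s ∈ symMaxIdeal k V) :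
    symAct G g s ∈ symMaxIdeal k V := by
  have : symMaxIdeal k V ≤ (symMaxIdeal k V).comap (symAct G g) := by
    refine Ideal.span_le.2 ?_
    rintro _ ⟨v, rfl⟩
    refine Ideal.subset_span ⟨((g : LinearMap.GeneralLinearGroup k V) : V →ₗ[k] V) v, ?_⟩
    simp [symAct]
  exact this hs

variable (k V) in
/-- The submodule `𝔪 {}^e S` of `{}^e S`. -/
def maxIdealFrobSym (p e : ℕ) [ExpChar k p] :
    Submodule (SymmetricAlgebra k V) (FrobTwist p e (SymmetricAlgebra k V)) :=
  symMaxIdeal k V • ⊤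

theorem maxIdealFrobSym_le_comap (p e : ℕ) [ExpChar k p] (g : G) :
    (maxIdealFrobSym k V p e).restrictScalars k ≤
      ((maxIdealFrobSym k V p e).restrictScalars k).comap (frobSymRep G p e g) := by
  intro x hx
  change x ∈ symMaxIdeal k V •
    (⊤ : Submodule (SymmetricAlgebra k V) (FrobTwist p e (SymmetricAlgebra k V))) at hx
  change frobSymRep G p e g x ∈ symMaxIdeal k V • (⊤ : Submodule (SymmetricAlgebra k V) _)
  refine Submodule.smul_induction_on hx (fun s hs y _ => ?_) (fun x y h1 h2 => ?_)
  · rw [isGSModule_frobSymRep]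
    exact Submodule.smul_mem_smul (symAct_mem_symMaxIdeal G g hs) trivial
  · rw [map_add]
    exact add_mem h1 h2

/-- The representation of `G` on `{}^e S / 𝔪 {}^e S`. -/
def frobFibreRep (p e : ℕ) [ExpChar k p] :
    Representation k G (FrobTwist p e (SymmetricAlgebra k V) ⧸
      (maxIdealFrobSym k V p e).restrictScalars k) :=
  (frobSymRep G p e).quotient _ (maxIdealFrobSym_le_comap G p e)

/-! ### Gradings

A grading on `M` is recorded by its homogeneous pieces `M_t`, for rational `t`. All pieces that
occur below vanish for `t` outside `(1/q)ℤ`. -/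

variable (k V) in
/-- `S_t`: the `n`-th symmetric power of `V` if `t = n` is a natural number, and zero otherwise. -/
def symPiece (t : ℚ) : Submodule k (SymmetricAlgebra k V) :=
  ⨆ (n : ℕ) (_ : (n : ℚ) = t), LinearMap.range (SymmetricAlgebra.ι k V) ^ n

/-- `R_t = R ∩ S_t`. -/
def invPiece (t : ℚ) : Submodule k (invariantRing G) :=
  (symPiece k V t).comap (invariantRing G).val.toLinearMap

variable (k V W) in
/-- `(S ⊗ W)_t = S_t ⊗ W`, that is, `W` is placed in degree zero. -/
def symTensorPiece (t : ℚ) : Submodule k (SymmetricAlgebra k V ⊗[k] W) :=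
  LinearMap.range ((symPiece k V t).subtype.rTensor W)

/-- `((S ⊗ W) ^ G)_t = (S ⊗ W) ^ G ∩ (S ⊗ W)_t`. -/
def covPiece (t : ℚ) : Submodule k (covariants G ρ) :=
  (symTensorPiece k V W t).comap ((covariants G ρ).subtype.restrictScalars k)

end Invariants

/-- The grading of `{}^e M`: `({}^e M)_t = {}^e (M_{q t})` with `q = p ^ e`. -/
def twistPiece (p e : ℕ) {k M : Type*} [CommRing k] [ExpChar k p] [AddCommGroup M] [Module k M]
    (𝒜 : ℚ → Submodule k M) (t : ℚ) : Submodule k (FrobTwist p e M) where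
  carrier := {x | (FrobTwist.of p e M).symm x ∈ 𝒜 ((p : ℚ) ^ e * t)}
  add_mem' ha hb := (𝒜 _).add_mem ha hb
  zero_mem' := (𝒜 _).zero_mem
  smul_mem' a _ hx := (𝒜 _).smul_mem (a ^ p ^ e) hx

/-- The grading of `⨁ j, M_j (-α_j)`, where `M (-a)_t = M_{t - a}`. -/
def shiftSumPiece {k ι : Type*} {M : ι → Type*} [CommRing k] [∀ j, AddCommMonoid (M j)]
    [∀ j, Module k (M j)] (𝒜 : ∀ j, ℚ → Submodule k (M j)) (α : ι → ℚ) (t : ℚ) :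
    Submodule k (⨁ j, M j) where
  carrier := {x | ∀ j, x j ∈ 𝒜 j (t - α j)}
  add_mem' ha hb j := by rw [DirectSum.add_apply]; exact add_mem (ha j) (hb j)
  zero_mem' j := by rw [DirectSum.zero_apply]; exact zero_mem _
  smul_mem' a x ha j := by rw [DirectSum.smul_apply]; exact Submodule.smul_mem _ a (ha j)

/-- The set `(1/q)ℤ` of degrees, as a subgroup of `ℚ`, with `q = p ^ e`. -/
def fracDegrees (p e : ℕ) : AddSubgroup ℚ := AddSubgroup.zmultiples (1 / (p : ℚ) ^ e)

/-- `φ` is homogeneous of degree zero, with homogeneous inverse, for the `(1/q)ℤ`-gradings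
`𝒜` and `ℬ`. -/
def IsGradedEquiv (p e : ℕ) {k M N : Type*} [CommRing k] [AddCommMonoid M] [Module k M]
    [AddCommMonoid N] [Module k N] (φ : M → N) (𝒜 : ℚ → Submodule k M) (ℬ : ℚ → Submodule k N) :
    Prop :=
  ∀ t ∈ fracDegrees p e, ∀ x : M, φ x ∈ ℬ t ↔ x ∈ 𝒜 t

/-! ### Irreducible representations -/

/-- `W 0, …, W n` is a complete set of pairwise non-isomorphic irreducible representations
of `Γ` over `k`, with `W 0` the trivial representation `k`. -/
structure IsCompleteIrreps {k : Type*} {Γ : Type*} [Field k] [Group Γ] {n : ℕ}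
    {W : Fin (n + 1) → Type w} [∀ i, AddCommGroup (W i)] [∀ i, Module k (W i)]
    (ρ : ∀ i, Representation k Γ (W i)) : Prop where
  irreducible : ∀ i, (ρ i).IsIrreducible
  pairwise_not_iso : ∀ i j, Nonempty ((ρ i).Equiv (ρ j)) → i = j
  complete : ∀ (X : Type w) [AddCommGroup X] [Module k X] (τ : Representation k Γ X),
    τ.IsIrreducible → ∃ i, Nonempty (τ.Equiv (ρ i))
  trivial_zero : Nonempty ((ρ 0).Equiv (Representation.trivial k Γ k))

end

/-! Write q = p ^ e. The implications form the cycle 4 → 5 → 1 → 2 → 3 → 4. Taking invariants gives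
4 → 5, forgetting degrees gives 5 → 1, and reduction modulo 𝔪 gives 2 → 3. The substance is in 1 → 2
and 3 → 4.

For 1 → 2, a (G, S)-module N that is free over S is recovered from its invariants M, because S ⊗_R M
→ N fails to be an isomorphism only in codimension two. This is made explicit by separating elements
s = ∑ aᵢ bᵢ with ∑ aᵢ (g bᵢ) = 0 for g ≠ 1: they satisfy s x = ∑ aᵢ Tr(bᵢ x), so s N lies in the
S-span of the invariants. Products of linear forms h v - v are separating. A prime dividing h v - v
for all v would force h - 1 to have rank one, so without pseudo-reflections the separating elements
have no common prime factor (`exists_isSeparating_not_prime_dvd`). Since S is factorial, an R-linear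
map between invariants therefore extends to the free modules (`IsInvariantsOf.exists_extension`),
uniquely and equivariantly. This applies to {}^e S, which is free over S (`FrobTwist.instFree`).

For 3 → 4, the order of G is invertible in k, so equivariant maps from W_i to the fibre lift to {}^e
S by Maschke, and splitting a lift into components makes it homogeneous. By Schur's lemma the
multiplicity c_i is the dimension of the space of such maps; hence a basis with homogeneous lifts
exists and decomposes the fibre (`Representation.exists_homogeneous_lift`). The lifts extend
S-linearly to ⨁ S ⊗ W_j → {}^e S, which is surjective by graded Nakayama and injective by Nakayama,
as {}^e S is projective (`exists_graded_gsEquiv`). -/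

noncomputable section

/-! ### Linear forms as primes of the factorial ring S -/

section LinearForms

variable {k V : Type*} [Field k] [AddCommGroup V] [Module k V]

instance SymmetricAlgebra.instUniqueFactorizationMonoid :
    UniqueFactorizationMonoid (SymmetricAlgebra k V) :=
  (SymmetricAlgebra.equivMvPolynomial
    (Module.Basis.ofVectorSpace k V)).symm.toMulEquiv.uniqueFactorizationMonoid inferInstance

theorem SymmetricAlgebra.ι_injective : Function.Injective (SymmetricAlgebra.ι k V) := by
  rw [← LinearMap.ker_eq_bot, eq_bot_iff]
  intro v hv
  by_contra hne
  obtain ⟨f, hf, -⟩ := Submodule.exists_le_ker_of_notMem (p := (⊥ : Submodule k V)) hne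
  apply hf
  rw [← SymmetricAlgebra.lift_ι_apply (f := f) v, LinearMap.mem_ker.1 hv, map_zero]

theorem SymmetricAlgebra.irreducible_ι {v : V} (hv : v ≠ 0) :
    Irreducible (SymmetricAlgebra.ι k V v) := by
  let b := Module.Basis.ofVectorSpace k V
  rw [← MulEquiv.irreducible_iff (SymmetricAlgebra.equivMvPolynomial b)]
  set P := SymmetricAlgebra.equivMvPolynomial b (SymmetricAlgebra.ι k V v) with hP
  have h0 : P ≠ 0 := by
    rw [hP, Ne, EmbeddingLike.map_eq_zero_iff]
    exact fun h => hv (SymmetricAlgebra.ι_injective (by rw [h, map_zero]))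
  have hhom : P.IsHomogeneous 1 := by
    have : P = ∑ i ∈ (b.repr v).support, b.repr v i • MvPolynomial.X i := by
      conv_lhs => rw [hP, ← b.linearCombination_repr v, Finsupp.linearCombination_apply,
        Finsupp.sum, map_sum, map_sum]
      simp
    rw [this]
    refine MvPolynomial.IsHomogeneous.sum _ _ _ fun i _ => ?_
    rw [MvPolynomial.smul_eq_C_mul]
    simpa using (MvPolynomial.isHomogeneous_C _ (b.repr v i)).mul (MvPolynomial.isHomogeneous_X k i)
  -- In total degree one, irreducibility only requires that every common divisor of the coefficients
  -- be a unit; over a field this means that some coefficient is nonzero.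
  refine MvPolynomial.irreducible_of_totalDegree_eq_one (hhom.totalDegree h0) fun x hx => ?_
  rw [isUnit_iff_ne_zero]
  rintro rfl
  exact h0 (MvPolynomial.ext _ _ fun i => by simpa using hx i)

/-- A prime dividing the irreducible form u is associated to it, so u would divide v. Evaluating at
a functional that kills u but not v excludes this. -/
theorem SymmetricAlgebra.not_prime_dvd_ι_of_notMem_span {π : SymmetricAlgebra k V} (hπ : Prime π)
    {u v : V} (hu : u ≠ 0) (hv : v ∉ Submodule.span k {u})
    (hπu : π ∣ SymmetricAlgebra.ι k V u) : ¬ π ∣ SymmetricAlgebra.ι k V v := by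
  intro hπv
  obtain ⟨f, hfv, hf⟩ := Submodule.exists_le_ker_of_notMem hv
  have hfu : f u = 0 := hf (Submodule.mem_span_singleton_self u)
  have huπ := (hπ.irreducible.dvd_symm (SymmetricAlgebra.irreducible_ι hu) hπu).trans hπv
  obtain ⟨c, hc⟩ := huπ
  apply hfv
  rw [← SymmetricAlgebra.lift_ι_apply (f := f) v, hc, map_mul, SymmetricAlgebra.lift_ι_apply, hfu,
    zero_mul]

end LinearForms

/-! ### Separating elements and pseudo-reflections -/

section Separating

variable {k V : Type*} [Field k] [AddCommGroup V] [Module k V]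
variable (G : Subgroup (LinearMap.GeneralLinearGroup k V))

@[simp] theorem symAct_ι (g : G) (v : V) :
    symAct G g (SymmetricAlgebra.ι k V v) = SymmetricAlgebra.ι k V
      (((g : LinearMap.GeneralLinearGroup k V) : V →ₗ[k] V) v) := by
  simp [symAct]

/-- `s` is separating if some `∑ aᵢ ⊗ bᵢ` in `S ⊗ S` satisfies `∑ aᵢ (g bᵢ) = s` for `g = 1` and
`∑ aᵢ (g bᵢ) = 0` for all other `g`. -/
def IsSeparating (s : SymmetricAlgebra k V) : Prop :=
  ∃ E : SymmetricAlgebra k V ⊗[k] SymmetricAlgebra k V,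
    Algebra.TensorProduct.productMap (AlgHom.id k _) (symAct G 1) E = s ∧
    ∀ g : G, g ≠ 1 → Algebra.TensorProduct.productMap (AlgHom.id k _) (symAct G g) E = 0

-- The tensor has one factor h v_h ⊗ 1 - 1 ⊗ v_h for each h ≠ 1. Twisting the second leg by g turns
-- it into h v_h - g v_h, which vanishes for h = g and equals h v_h - v_h for g = 1.
open Classical in
theorem isSeparating_prod [Fintype G] (v : G → V) :
    IsSeparating G (∏ h ∈ Finset.univ.erase (1 : G), SymmetricAlgebra.ι k V
      (((h : LinearMap.GeneralLinearGroup k V) : V →ₗ[k] V) (v h) - v h)) := by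
  refine ⟨∏ h ∈ Finset.univ.erase (1 : G), (symAct G h (SymmetricAlgebra.ι k V (v h)) ⊗ₜ 1 -
    1 ⊗ₜ SymmetricAlgebra.ι k V (v h)), ?_, fun g hg => ?_⟩
  · simp [map_prod]
  · rw [map_prod]
    refine Finset.prod_eq_zero (Finset.mem_erase.2 ⟨hg, Finset.mem_univ g⟩) ?_
    simp

/-- If π divided every g v - v, all these forms would be proportional to a single nonzero one, and g
- 1 would have rank one. -/
theorem exists_not_prime_dvd_sub {g : LinearMap.GeneralLinearGroup k V} (hg : g ≠ 1)
    (hrefl : ¬ IsPseudoReflection g) {π : SymmetricAlgebra k V} (hπ : Prime π) :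
    ∃ v : V, ¬ π ∣ SymmetricAlgebra.ι k V ((g : V →ₗ[k] V) v - v) := by
  by_contra! h
  have h1 : ∃ v, (g : V →ₗ[k] V) v - v ≠ 0 := by
    by_contra! h1
    refine hg (Units.ext (LinearMap.ext fun v => ?_))
    exact sub_eq_zero.1 (h1 v)
  obtain ⟨v, hv⟩ := h1
  apply hrefl
  have : LinearMap.range ((g : V →ₗ[k] V) - 1) =
      Submodule.span k {(g : V →ₗ[k] V) v - v} := by
    apply le_antisymm
    · rintro _ ⟨w, rfl⟩
      by_contra hw
      exact SymmetricAlgebra.not_prime_dvd_ι_of_notMem_span hπ hv hw (h v) (h w)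
    · rw [Submodule.span_singleton_le_iff_mem]
      exact ⟨v, rfl⟩
  rw [IsPseudoReflection, this, finrank_span_singleton hv]

variable {G} in
theorem exists_isSeparating_not_prime_dvd [Finite G] (hrefl : ∀ g ∈ G, ¬ IsPseudoReflection g)
    {π : SymmetricAlgebra k V} (hπ : Prime π) : ∃ s, IsSeparating G s ∧ ¬ π ∣ s := by
  classical
  have := Fintype.ofFinite G
  have (h : G) : ∃ v : V, h ≠ 1 → ¬ π ∣ SymmetricAlgebra.ι k V
      (((h : LinearMap.GeneralLinearGroup k V) : V →ₗ[k] V) v - v) := by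
    by_cases hh : h = 1
    · exact ⟨0, fun h1 => absurd hh h1⟩
    · obtain ⟨v, hv⟩ := exists_not_prime_dvd_sub (g := (h : LinearMap.GeneralLinearGroup k V))
        (by simpa using hh) (hrefl h h.2) hπ
      exact ⟨v, fun _ => hv⟩
  choose v hv using this
  refine ⟨_, isSeparating_prod G v, fun hdvd => ?_⟩
  obtain ⟨h, hh, hd⟩ := hπ.exists_mem_finset_dvd hdvd
  exact hv h (Finset.ne_of_mem_erase hh) hd

theorem exists_isSeparating_ne_zero [Finite G] : ∃ s, IsSeparating G s ∧ s ≠ 0 := by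
  classical
  have := Fintype.ofFinite G
  have (h : G) : ∃ v : V, h ≠ 1 →
      ((h : LinearMap.GeneralLinearGroup k V) : V →ₗ[k] V) v - v ≠ 0 := by
    by_contra! h1
    refine (h1 0).1 (Subtype.ext (Units.ext (LinearMap.ext fun v => ?_)))
    exact sub_eq_zero.1 (h1 v).2
  choose v hv using this
  refine ⟨_, isSeparating_prod G v, ?_⟩
  rw [Finset.prod_ne_zero_iff]
  intro h hh h0
  exact hv h (Finset.ne_of_mem_erase hh) (SymmetricAlgebra.ι_injective (by rw [h0, map_zero]))

variable {G} {N : Type*} [AddCommMonoid N] [Module k N] [Module (SymmetricAlgebra k V) N]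
  {σ : Representation k G N}

/-- For E = ∑ aᵢ ⊗ bᵢ, the sum over g of (∑ aᵢ (g bᵢ)) (g x) equals ∑ aᵢ Tr(bᵢ x), where Tr is the
norm map ∑ g of the representation. Only the term g = 1 survives on the left, and it is s x. -/
theorem IsSeparating.smul_mem_span_norm [Fintype G] {s : SymmetricAlgebra k V}
    (hs : IsSeparating G s) (hσ : IsGSModule G σ) (x : N) :
    s • x ∈ Submodule.span (SymmetricAlgebra k V)
      (Set.range fun d : SymmetricAlgebra k V => σ.norm (d • x)) := by
  obtain ⟨E, h1, hE⟩ := hs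
  have key : ∑ g : G, Algebra.TensorProduct.productMap (AlgHom.id k _) (symAct G g) E • σ g x ∈
      Submodule.span (SymmetricAlgebra k V)
        (Set.range fun d : SymmetricAlgebra k V => σ.norm (d • x)) := by
    clear hE h1
    induction E with
    | zero => simp
    | add E E' h h' =>
      simp only [map_add, add_smul, Finset.sum_add_distrib]
      exact add_mem h h'
    | tmul a b =>
      have : ∑ g : G, Algebra.TensorProduct.productMap (AlgHom.id k _) (symAct G g) (a ⊗ₜ b) •
          σ g x = a • σ.norm (b • x) := by
        simp [Representation.norm, Finset.smul_sum, hσ _ _ _, mul_smul]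
      rw [this]
      exact Submodule.smul_mem _ _ (Submodule.subset_span ⟨b, rfl⟩)
  rw [Finset.sum_eq_single 1 (fun g _ hg => by rw [hE g hg, zero_smul]) (by simp), h1, map_one]
    at key
  exact key

end Separating

/-! ### Recovering a free (G, S)-module from its invariants -/

section Extension

variable {k V : Type*} [Field k] [AddCommGroup V] [Module k V]
variable {G : Subgroup (LinearMap.GeneralLinearGroup k V)}

/-- If all `s * y`, with `s` running through a set without common prime factor, are divisible by
`a`, then so is `y`. -/
theorem dvd_of_forall_dvd_mul {A : Type*} [CommRing A] [IsDomain A] [UniqueFactorizationMonoid A]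
    {P : A → Prop} (h0 : ∃ s, P s ∧ s ≠ 0) (hP : ∀ π, Prime π → ∃ s, P s ∧ ¬ π ∣ s) (a : A) :
    ∀ y, (∀ s, P s → a ∣ s * y) → a ∣ y := by
  induction a using UniqueFactorizationMonoid.induction_on_prime with
  | h₁ =>
    intro y hy
    obtain ⟨s, hs, hs0⟩ := h0
    have := hy s hs
    rw [zero_dvd_iff] at this ⊢
    exact (mul_eq_zero.1 this).resolve_left hs0
  | h₂ a ha => exact fun y _ => ha.dvd
  | h₃ a π ha hπ ih =>
    intro y hy
    -- An s prime to π shows that π divides y; after cancelling π the induction hypothesis applies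
    -- to the quotient.
    obtain ⟨s, hs, hπs⟩ := hP π hπ
    obtain ⟨z, rfl⟩ := (hπ.dvd_or_dvd ((dvd_mul_right π a).trans (hy s hs))).resolve_left hπs
    refine mul_dvd_mul_left π (ih z fun t ht => ?_)
    refine (mul_dvd_mul_iff_left hπ.ne_zero).1 ?_
    rw [mul_left_comm]
    exact hy t ht

theorem exists_smul_eq_of_forall_isSeparating [Finite G] (hrefl : ∀ g ∈ G, ¬ IsPseudoReflection g)
    {N : Type*} [AddCommMonoid N] [Module (SymmetricAlgebra k V) N]
    [Module.Free (SymmetricAlgebra k V) N] (a : SymmetricAlgebra k V) (y : N)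
    (hy : ∀ s, IsSeparating G s → ∃ z : N, s • y = a • z) : ∃ z : N, y = a • z := by
  let b := Module.Free.chooseBasis (SymmetricAlgebra k V) N
  have hdvd (j) : a ∣ b.repr y j := by
    refine dvd_of_forall_dvd_mul (exists_isSeparating_ne_zero G)
      (fun π hπ => exists_isSeparating_not_prime_dvd hrefl hπ) a _ fun s hs => ?_
    obtain ⟨z, hz⟩ := hy s hs
    refine ⟨b.repr z j, ?_⟩
    simpa using congr(b.repr $hz j)
  choose c hc using hdvd
  classical
  refine ⟨∑ j ∈ (b.repr y).support, c j • b j, ?_⟩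
  conv_lhs => rw [← b.linearCombination_repr y, Finsupp.linearCombination_apply, Finsupp.sum]
  rw [Finset.smul_sum]
  exact Finset.sum_congr rfl fun j _ => by rw [smul_smul, ← hc]

variable {N N' M M' : Type*}
  [AddCommMonoid N] [Module k N] [Module (SymmetricAlgebra k V) N]
  [AddCommMonoid N'] [Module k N'] [Module (SymmetricAlgebra k V) N']
  [AddCommMonoid M] [Module (invariantRing G) M] [AddCommMonoid M'] [Module (invariantRing G) M']
  {σ : Representation k G N} {τ : Representation k G N'} {i : M →+ N} {i' : M' →+ N'}

/-- `i : M → N` identifies the module `M` over `R = S ^ G` with the invariants of `N`. -/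
structure IsInvariantsOf (σ : Representation k G N) (i : M →+ N) : Prop where
  injective : Function.Injective i
  map_coe_smul : ∀ (r : invariantRing G) (m : M), i (r • m) = (r : SymmetricAlgebra k V) • i m
  rep_apply : ∀ (g : G) (m : M), σ g (i m) = i m
  exists_eq : ∀ x : N, (∀ g, σ g x = x) → ∃ m, i m = x

/-- `i` as a linear map over the invariant ring. -/
def IsInvariantsOf.toLinearMap (hi : IsInvariantsOf σ i) : M →ₗ[invariantRing G] N :=
  { i with map_smul' := hi.map_coe_smul }

@[simp] theorem IsInvariantsOf.toLinearMap_apply (hi : IsInvariantsOf σ i) (m : M) :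
    hi.toLinearMap m = i m := rfl

theorem IsGSModule.smul_norm [Fintype G] (hσ : IsGSModule G σ) (r : invariantRing G) (x : N) :
    (r : SymmetricAlgebra k V) • σ.norm x = σ.norm ((r : SymmetricAlgebra k V) • x) := by
  simp only [Representation.norm, LinearMap.sum_apply, Finset.smul_sum]
  exact Finset.sum_congr rfl fun g _ => by rw [hσ, r.2 g]

theorem IsGSModule.norm_smul_of_invariant [Fintype G] (hσ : IsGSModule G σ)
    (d : SymmetricAlgebra k V) {x : N} (hx : ∀ g, σ g x = x) :
    σ.norm (d • x) = (symRep G).norm d • x := by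
  simp only [Representation.norm, LinearMap.sum_apply, Finset.sum_smul]
  exact Finset.sum_congr rfl fun g _ => by rw [hσ, hx g, symRep_apply]

variable (G) in
/-- The trace `∑ g d` of an element of `S`, as an element of `R`. -/
def symTrace [Fintype G] (d : SymmetricAlgebra k V) : invariantRing G :=
  ⟨(symRep G).norm d, fun g => (symRep G).self_norm_apply g d⟩

theorem symTrace_mul [Fintype G] (r : invariantRing G) (d : SymmetricAlgebra k V) :
    symTrace G ((r : SymmetricAlgebra k V) * d) = r * symTrace G d := by
  apply Subtype.ext
  exact (IsGSModule.smul_norm (σ := symRep G) (fun g s x => map_mul (symAct G g) s x) r d).symm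

/-- `a ⊗ m ↦ (∑ g (d a)) m` on `S ⊗ M`. -/
def traceContract [Fintype G] (M : Type*) [AddCommMonoid M] [Module (invariantRing G) M]
    (d : SymmetricAlgebra k V) : SymmetricAlgebra k V ⊗[invariantRing G] M →ₗ[invariantRing G] M :=
  TensorProduct.lift
    { toFun := fun a => LinearMap.lsmul (invariantRing G) M (symTrace G (d * a))
      map_add' := fun a b => by
        rw [mul_add, ← map_add]
        congr 1
        exact Subtype.ext (map_add _ _ _)
      map_smul' := fun r a => by
        rw [RingHom.id_apply, ← map_smul, smul_eq_mul, ← symTrace_mul]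
        congr 2
        exact mul_left_comm _ _ _ }

/-- An invariant y satisfies Tr(d a y) = Tr(d a) y. Hence the traces of the image of z in N are
already determined by elements of M', before f is applied. -/
theorem IsInvariantsOf.map_traceContract [Fintype G] (hi : IsInvariantsOf σ i)
    (hσ : IsGSModule G σ) (f : M' →ₗ[invariantRing G] M) (d : SymmetricAlgebra k V)
    (z : SymmetricAlgebra k V ⊗[invariantRing G] M') :
    i (f (traceContract M' d z)) =
      σ.norm (d • (hi.toLinearMap ∘ₗ f).liftBaseChange (SymmetricAlgebra k V) z) := by
  induction z with
  | zero => simp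
  | add z z' h h' => simp only [map_add, smul_add, h, h']
  | tmul a m =>
    rw [LinearMap.liftBaseChange_tmul, smul_smul, LinearMap.comp_apply, hi.toLinearMap_apply,
      hσ.norm_smul_of_invariant _ fun g => hi.rep_apply g _]
    have : traceContract M' d (a ⊗ₜ m) = symTrace G (d * a) • m := TensorProduct.lift.tmul _ _
    rw [this, _root_.map_smul, hi.map_coe_smul]
    rfl

/-- If z dies in N, then all its trace contractions vanish in M, hence so do all traces of d times
its image in N'. A nonzero separating element kills that image, which is zero by torsion-freeness.
-/
theorem IsInvariantsOf.liftBaseChange_eq_zero [Finite G]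
    [Module.IsTorsionFree (SymmetricAlgebra k V) N']
    (hi : IsInvariantsOf σ i) (hi' : IsInvariantsOf τ i') (hσ : IsGSModule G σ)
    (hτ : IsGSModule G τ) (f : M →ₗ[invariantRing G] M')
    (z : SymmetricAlgebra k V ⊗[invariantRing G] M)
    (hz : hi.toLinearMap.liftBaseChange (SymmetricAlgebra k V) z = 0) :
    (hi'.toLinearMap ∘ₗ f).liftBaseChange (SymmetricAlgebra k V) z = 0 := by
  have := Fintype.ofFinite G
  obtain ⟨s, hs, hs0⟩ := exists_isSeparating_ne_zero G
  refine (smul_eq_zero.1 (?_ : s • _ = (0 : N'))).resolve_left hs0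
  have key := hs.smul_mem_span_norm hτ
    ((hi'.toLinearMap ∘ₗ f).liftBaseChange (SymmetricAlgebra k V) z)
  rw [← Submodule.mem_bot (SymmetricAlgebra k V)]
  refine (Submodule.span_le.2 ?_) key
  rintro _ ⟨d, rfl⟩
  have h1 : traceContract M d z = 0 := by
    apply hi.injective
    have := hi.map_traceContract hσ LinearMap.id d z
    rw [LinearMap.comp_id, hz, smul_zero, map_zero] at this
    rw [map_zero]
    exact this
  have h2 := hi'.map_traceContract hτ f d z
  rw [h1, map_zero, map_zero] at h2
  exact h2.symm

theorem IsInvariantsOf.smul_mem_range_liftBaseChange [Finite G] (hi : IsInvariantsOf σ i)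
    (hσ : IsGSModule G σ) {s : SymmetricAlgebra k V} (hs : IsSeparating G s) (x : N) :
    ∃ z, hi.toLinearMap.liftBaseChange (SymmetricAlgebra k V) z = s • x := by
  have := Fintype.ofFinite G
  have key := hs.smul_mem_span_norm hσ x
  rw [← LinearMap.mem_range]
  refine (Submodule.span_le.2 ?_) key
  rintro _ ⟨d, rfl⟩
  obtain ⟨m, hm⟩ := hi.exists_eq (σ.norm (d • x)) fun g => σ.self_norm_apply g _
  refine ⟨1 ⊗ₜ m, ?_⟩
  rw [LinearMap.liftBaseChange_tmul, one_smul, hi.toLinearMap_apply, hm]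

/-- A nonzero multiple s x lies in the S-span of the invariants, and the target has no torsion. -/
theorem IsInvariantsOf.linearMap_ext [Finite G] {L : Type*} [AddCommMonoid L]
    [Module (SymmetricAlgebra k V) L] [Module.IsTorsionFree (SymmetricAlgebra k V) L]
    (hi : IsInvariantsOf σ i) (hσ : IsGSModule G σ) {F F' : N →ₗ[SymmetricAlgebra k V] L}
    (h : ∀ m, F (i m) = F' (i m)) : F = F' := by
  have := Fintype.ofFinite G
  obtain ⟨s, hs, hs0⟩ := exists_isSeparating_ne_zero G
  let _ : AddCommGroup L := Module.addCommMonoidToAddCommGroup (SymmetricAlgebra k V)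
  ext x
  rw [← sub_eq_zero]
  refine (smul_eq_zero.1 (?_ : s • _ = (0 : L))).resolve_left hs0
  rw [← LinearMap.sub_apply, ← map_smul, ← LinearMap.mem_ker]
  refine (Submodule.span_le.2 ?_) (hs.smul_mem_span_norm hσ x)
  rintro _ ⟨d, rfl⟩
  obtain ⟨m, hm⟩ := hi.exists_eq (σ.norm (d • x)) fun g => σ.self_norm_apply g _
  simp [← hm, h]

/-- With μ : S ⊗ M → N and Φ : S ⊗ M → N' induced by the inclusion and by f, the extension is F x =
s⁻¹ Φ(μ⁻¹(s x)) for a fixed nonzero separating s. The kernel condition makes this independent of the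
preimage; the division by s is possible because separating elements have no common prime factor. -/
theorem IsInvariantsOf.exists_extension [Finite G] (hrefl : ∀ g ∈ G, ¬ IsPseudoReflection g)
    [Module.Free (SymmetricAlgebra k V) N']
    (hi : IsInvariantsOf σ i) (hi' : IsInvariantsOf τ i') (hσ : IsGSModule G σ)
    (hτ : IsGSModule G τ) (f : M →ₗ[invariantRing G] M') :
    ∃ F : N →ₗ[SymmetricAlgebra k V] N', ∀ m, F (i m) = i' (f m) := by
  set μ := hi.toLinearMap.liftBaseChange (SymmetricAlgebra k V) with hμ
  set Φ := (hi'.toLinearMap ∘ₗ f).liftBaseChange (SymmetricAlgebra k V) with hΦ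
  have hker (z z') (h : μ z = μ z') : Φ z = Φ z' := by
    let _ : AddCommGroup M := Module.addCommMonoidToAddCommGroup (invariantRing G)
    let _ : AddCommGroup N := Module.addCommMonoidToAddCommGroup (SymmetricAlgebra k V)
    let _ : AddCommGroup N' := Module.addCommMonoidToAddCommGroup (SymmetricAlgebra k V)
    rw [← sub_eq_zero, ← map_sub] at h ⊢
    exact hi.liftBaseChange_eq_zero hi' hσ hτ f _ h
  have hrange (s : SymmetricAlgebra k V) (hs : IsSeparating G s) (x : N) : ∃ z, μ z = s • x :=
    hi.smul_mem_range_liftBaseChange hσ hs x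
  obtain ⟨s, hs, hs0⟩ := exists_isSeparating_ne_zero G
  have hF (x : N) : ∃ y : N', ∀ z, μ z = s • x → Φ z = s • y := by
    obtain ⟨z, hz⟩ := hrange s hs x
    -- For separating t, let μ z' = t x. Then t z and s z' have the same image under μ, so t Φ(z) =
    -- s Φ(z') is divisible by s for every t.
    obtain ⟨y, hy⟩ := exists_smul_eq_of_forall_isSeparating hrefl s (Φ z) fun t ht => by
      obtain ⟨z', hz'⟩ := hrange t ht x
      refine ⟨Φ z', ?_⟩
      rw [← map_smul, ← map_smul]
      refine hker _ _ ?_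
      rw [map_smul, map_smul, hz, hz', smul_comm]
    exact ⟨y, fun z' hz' => by rw [hker z' z (hz'.trans hz.symm), hy]⟩
  choose F hF using hF
  refine ⟨{ toFun := F, map_add' := fun x y => ?_, map_smul' := fun a x => ?_ }, fun m => ?_⟩
  · obtain ⟨z, hz⟩ := hrange s hs x
    obtain ⟨z', hz'⟩ := hrange s hs y
    refine smul_right_injective N' hs0 ?_
    dsimp only
    rw [← hF (x + y) (z + z') (by rw [map_add, hz, hz', smul_add]), map_add, hF x z hz,
      hF y z' hz', smul_add]
  · obtain ⟨z, hz⟩ := hrange s hs x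
    refine smul_right_injective N' hs0 ?_
    dsimp only
    rw [← hF (a • x) (a • z) (by rw [map_smul, hz, smul_comm]), map_smul, hF x z hz, smul_comm,
      RingHom.id_apply]
  · refine smul_right_injective N' hs0 ?_
    dsimp only [LinearMap.coe_mk, AddHom.coe_mk]
    rw [← hF (i m) (s ⊗ₜ m) (by simp [hμ])]
    simp [hΦ]

/-- Over a group without pseudo-reflections, a `(G, S)`-module which is free over `S` is determined
by its module of invariants. -/
theorem IsInvariantsOf.nonempty_gsEquiv [Finite G] (hrefl : ∀ g ∈ G, ¬ IsPseudoReflection g)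
    [Module.Free (SymmetricAlgebra k V) N] [Module.Free (SymmetricAlgebra k V) N']
    (hi : IsInvariantsOf σ i) (hi' : IsInvariantsOf τ i') (hσ : IsGSModule G σ)
    (hτ : IsGSModule G τ) (f : M ≃ₗ[invariantRing G] M') : Nonempty (GSEquiv G σ τ) := by
  obtain ⟨F, hF⟩ := hi.exists_extension hrefl hi' hσ hτ f.toLinearMap
  obtain ⟨F', hF'⟩ := hi'.exists_extension hrefl hi hτ hσ f.symm.toLinearMap
  have h1 : F' ∘ₗ F = LinearMap.id := hi.linearMap_ext hσ fun m => by simp [hF, hF']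
  have h2 : F ∘ₗ F' = LinearMap.id := hi'.linearMap_ext hτ fun m => by simp [hF, hF']
  refine ⟨⟨LinearEquiv.ofLinearMap F F' h2 h1, fun g x => ?_⟩⟩
  change F (σ g x) = τ g (F x)
  -- The conjugate g⁻¹ F g is again S-linear and agrees with F on invariants, so it equals F; this
  -- is equivariance.
  let F'' : N →ₗ[SymmetricAlgebra k V] N' :=
    { toFun := fun x => τ g⁻¹ (F (σ g x))
      map_add' := fun x y => by simp
      map_smul' := fun a x => by
        rw [hσ, map_smul, hτ, ← AlgHom.mul_apply, ← map_mul, inv_mul_cancel, map_one,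
          AlgHom.one_apply, RingHom.id_apply] }
  have : F'' = F := hi.linearMap_ext hσ fun m => by
    simp [F'', hi.rep_apply, hF, hi'.rep_apply]
  rw [← LinearMap.congr_fun this x]
  change _ = τ g (τ g⁻¹ _)
  rw [← Module.End.mul_apply, ← map_mul, mul_inv_cancel, map_one, Module.End.one_apply]

end Extension

/-! ### Freeness of {}^e S over S -/

section FrobeniusFree

variable {k V : Type*} [Field k] [AddCommGroup V] [Module k V]

theorem MvPolynomial.coeff_pow_expChar_pow {σ : Type*} (p e : ℕ) [ExpChar k p]
    (P : MvPolynomial σ k) (u : σ →₀ ℕ) :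
    (P ^ p ^ e).coeff (p ^ e • u) = P.coeff u ^ p ^ e := by
  have hq : p ^ e ≠ 0 := (expChar_pow_pos k p e).ne'
  rw [← MvPolynomial.map_iterateFrobenius_expand, MvPolynomial.coeff_map,
    MvPolynomial.coeff_expand_smul _ hq, iterateFrobenius_def]

theorem MvPolynomial.coeff_pow_expChar_pow_of_not_dvd {σ : Type*} (p e : ℕ) [ExpChar k p]
    (P : MvPolynomial σ k) {u : σ →₀ ℕ} {i : σ} (h : ¬ p ^ e ∣ u i) :
    (P ^ p ^ e).coeff u = 0 := by
  rw [← MvPolynomial.map_iterateFrobenius_expand, MvPolynomial.coeff_map,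
    MvPolynomial.coeff_expand_of_not_dvd _ h, map_zero]

variable (k V) in
/-- `{}^e S` is free over `S`, with basis the monomials with all exponents less than `p ^ e`. -/
instance FrobTwist.instFree [IsAlgClosed k] (p e : ℕ) [ExpChar k p] :
    Module.Free (SymmetricAlgebra k V) (FrobTwist p e (SymmetricAlgebra k V)) := by
  let b := Module.Basis.ofVectorSpace k V
  let E := SymmetricAlgebra.equivMvPolynomial b
  let σ := Module.Basis.ofVectorSpaceIndex k V
  let I := {a : σ →₀ ℕ // ∀ i, a i < p ^ e}
  have hq : 0 < p ^ e := expChar_pow_pos k p e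
  let v : I → FrobTwist p e (SymmetricAlgebra k V) :=
    fun a => FrobTwist.of p e _ (E.symm (MvPolynomial.monomial a.1 1))
  have hli : LinearIndependent (SymmetricAlgebra k V) v := by
    rw [linearIndependent_iff']
    intro s g hg a ha
    have h1 : ∑ c ∈ s, E (g c) ^ p ^ e * MvPolynomial.monomial c.1 1 = 0 := by
      have h2 : FrobTwist.of p e _
          (∑ c ∈ s, g c ^ p ^ e • E.symm (MvPolynomial.monomial c.1 1)) = 0 := by
        rw [map_sum, ← hg]
        exact Finset.sum_congr rfl fun c _ => (FrobTwist.smul_of _ _ _).symm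
      rw [map_eq_zero_iff _ (FrobTwist.of p e _).injective] at h2
      simpa using congr(E $h2)
    rw [← map_eq_zero_iff E E.injective]
    ext u
    -- The exponents of a q-th power are divisible by q, and residues modulo q separate the
    -- exponents in `I`. So only the summand of a contributes at q u + a, with value (coefficient of
    -- g a at u) ^ q.
    have h2 := congr(MvPolynomial.coeff (p ^ e • u + a.1) $h1)
    rw [MvPolynomial.coeff_sum, Finset.sum_eq_single_of_mem a ha,
      MvPolynomial.coeff_mul_monomial, mul_one, MvPolynomial.coeff_pow_expChar_pow,
      MvPolynomial.coeff_zero] at h2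
    · rw [MvPolynomial.coeff_zero]
      exact eq_zero_of_pow_eq_zero h2
    · intro c _ hca
      rw [MvPolynomial.coeff_mul_monomial']
      split_ifs with hle
      · obtain ⟨i, hi⟩ : ∃ i, c.1 i ≠ a.1 i := by
          by_contra! h
          exact hca (Subtype.ext (Finsupp.ext h))
        rw [mul_one]
        refine MvPolynomial.coeff_pow_expChar_pow_of_not_dvd p e _ (i := i) fun hd => hi ?_
        have hle' := hle i
        simp only [Finsupp.coe_tsub, Finsupp.coe_add, Finsupp.coe_smul, Pi.sub_apply, Pi.add_apply,
          Pi.smul_apply, smul_eq_mul] at hd hle'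
        have hmod : c.1 i ≡ p ^ e * u i + a.1 i [MOD p ^ e] := (Nat.modEq_iff_dvd' hle').2 hd
        have : c.1 i ≡ a.1 i [MOD p ^ e] := by
          refine hmod.trans ?_
          simp [Nat.ModEq]
        exact Nat.ModEq.eq_of_lt_of_lt this (c.2 i) (a.2 i)
      · rfl
  have hsp : ⊤ ≤ Submodule.span (SymmetricAlgebra k V) (Set.range v) := by
    rintro x -
    obtain ⟨x, rfl⟩ := (FrobTwist.of p e _).surjective x
    obtain ⟨P, rfl⟩ := E.symm.surjective x
    induction P using MvPolynomial.induction_on' with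
    | add P Q hP hQ => rw [map_add, map_add]; exact add_mem hP hQ
    | monomial u c =>
      -- The coefficient needs a q-th root because scalars act on {}^e S through their q-th powers;
      -- the exponent is divided by q with remainder.
      obtain ⟨d, rfl⟩ := IsAlgClosed.exists_pow_nat_eq c hq
      let a : I := ⟨u.mapRange (· % p ^ e) (Nat.zero_mod _), fun i => by
        rw [Finsupp.mapRange_apply]; exact Nat.mod_lt _ hq⟩
      let w : σ →₀ ℕ := u.mapRange (· / p ^ e) (Nat.zero_div _)
      have huw : u = p ^ e • w + a.1 := by
        ext i
        rw [Finsupp.add_apply, Finsupp.smul_apply, Finsupp.mapRange_apply, Finsupp.mapRange_apply,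
          smul_eq_mul, Nat.div_add_mod]
      have : FrobTwist.of p e (SymmetricAlgebra k V) (E.symm (MvPolynomial.monomial u (d ^ p ^ e)))
          = E.symm (MvPolynomial.monomial w d) • v a := by
        rw [FrobTwist.smul_of, smul_eq_mul, ← map_pow, ← map_mul, MvPolynomial.monomial_pow,
          MvPolynomial.monomial_mul, mul_one, ← huw]
      rw [this]
      exact Submodule.smul_mem _ _ (Submodule.subset_span ⟨a, rfl⟩)
  exact Module.Free.of_basis (Module.Basis.mk hli hsp)

end FrobeniusFree

/-! ### The grading of the symmetric algebra -/

section Grading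

namespace SymmetricAlgebra

variable (R M : Type*) [CommRing R] [AddCommGroup M] [Module R M]

/-- `ι` as a map into the direct sum of the symmetric powers. -/
nonrec def GradedAlgebra.ι : M →ₗ[R] ⨁ i : ℕ, ↥(LinearMap.range (ι R M) ^ i) :=
  DirectSum.lof R ℕ (fun i => ↥(LinearMap.range (ι R M) ^ i)) 1 ∘ₗ
    (ι R M).codRestrict _ fun m => by simpa only [pow_one] using LinearMap.mem_range_self _ m

theorem GradedAlgebra.ι_apply (m : M) :
    GradedAlgebra.ι R M m =
      DirectSum.of (fun (i : ℕ) => ↥(LinearMap.range (SymmetricAlgebra.ι R M) ^ i)) 1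
        ⟨SymmetricAlgebra.ι R M m, by
          simpa only [pow_one] using LinearMap.mem_range_self _ m⟩ :=
  rfl

/-- The symmetric algebra is graded by the powers of the range of `ι`. -/
instance gradedAlgebra :
    GradedAlgebra ((LinearMap.range (ι R M) ^ ·) : ℕ → Submodule R (SymmetricAlgebra R M)) :=
  GradedAlgebra.ofAlgHom _ (lift <| GradedAlgebra.ι R M)
    (by
      apply SymmetricAlgebra.algHom_ext
      ext m
      change DirectSum.coeAlgHom _ (lift _ (SymmetricAlgebra.ι R M m)) = SymmetricAlgebra.ι R M m
      rw [lift_ι_apply, GradedAlgebra.ι_apply R M, DirectSum.coeAlgHom_of, Subtype.coe_mk])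
    fun i x => by
    obtain ⟨x, hx⟩ := x
    dsimp only [Subtype.coe_mk, DirectSum.lof_eq_of]
    induction hx using Submodule.pow_induction_on_left' with
    | algebraMap r =>
      rw [AlgHom.commutes, DirectSum.algebraMap_apply]; rfl
    | add x y i hx hy ihx ihy =>
      rw [map_add, ihx, ihy, ← map_add]
      rfl
    | mem_mul m hm i x hx ih =>
      obtain ⟨_, rfl⟩ := hm
      rw [map_mul, ih, lift_ι_apply, GradedAlgebra.ι_apply R M, DirectSum.of_mul_of]
      exact DirectSum.of_eq_of_gradedMonoid_eq (Sigma.subtype_ext (add_comm _ _) rfl)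

end SymmetricAlgebra

variable {k V : Type*} [Field k] [AddCommGroup V] [Module k V]

theorem symPiece_natCast (n : ℕ) :
    symPiece k V (n : ℚ) = LinearMap.range (SymmetricAlgebra.ι k V) ^ n := by
  apply le_antisymm
  · refine iSup₂_le fun m hm => ?_
    rw [Nat.cast_inj.1 hm]
  · exact le_iSup₂_of_le n rfl le_rfl

theorem symPiece_eq_bot {t : ℚ} (ht : ∀ n : ℕ, (n : ℚ) ≠ t) : symPiece k V t = ⊥ :=
  eq_bot_iff.2 (iSup₂_le fun n hn => absurd hn (ht n))

theorem mul_mem_symPiece {s t : ℚ} {x y : SymmetricAlgebra k V} (hx : x ∈ symPiece k V s)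
    (hy : y ∈ symPiece k V t) : x * y ∈ symPiece k V (s + t) := by
  by_cases hs : ∃ n : ℕ, (n : ℚ) = s
  · by_cases ht : ∃ n : ℕ, (n : ℚ) = t
    · obtain ⟨m, rfl⟩ := hs
      obtain ⟨n, rfl⟩ := ht
      rw [← Nat.cast_add, symPiece_natCast, pow_add]
      rw [symPiece_natCast] at hx hy
      exact Submodule.mul_mem_mul hx hy
    · rw [symPiece_eq_bot (by simpa using ht)] at hy
      rw [(Submodule.mem_bot k).1 hy, mul_zero]
      exact zero_mem _
  · rw [symPiece_eq_bot (by simpa using hs)] at hx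
    rw [(Submodule.mem_bot k).1 hx, zero_mul]
    exact zero_mem _

variable (G : Subgroup (LinearMap.GeneralLinearGroup k V))

theorem symAct_mem_range_pow (g : G) {n : ℕ} {x : SymmetricAlgebra k V}
    (hx : x ∈ LinearMap.range (SymmetricAlgebra.ι k V) ^ n) :
    symAct G g x ∈ LinearMap.range (SymmetricAlgebra.ι k V) ^ n := by
  have h : (LinearMap.range (SymmetricAlgebra.ι k V)).map (symAct G g).toLinearMap ≤
      LinearMap.range (SymmetricAlgebra.ι k V) := by
    rintro _ ⟨_, ⟨v, rfl⟩, rfl⟩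
    exact ⟨_, (symAct_ι G g v).symm⟩
  have h2 := Submodule.mem_map_of_mem (f := (symAct G g).toLinearMap) hx
  rw [Submodule.map_pow] at h2
  exact (pow_le_pow_left' h n) h2

end Grading

/-! ### Reduction modulo 𝔪 -/

section Fibre

variable {k V : Type*} [Field k] [AddCommGroup V] [Module k V]

theorem SymmetricAlgebra.sub_algebraMap_mem_symMaxIdeal (s : SymmetricAlgebra k V) :
    s - algebraMap k _ (SymmetricAlgebra.algebraMapInv s) ∈ symMaxIdeal k V := by
  induction s using SymmetricAlgebra.induction with
  | algebraMap r => simp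
  | ι v =>
    rw [SymmetricAlgebra.algebraMapInv_ι, map_zero, sub_zero]
    exact Ideal.subset_span ⟨v, rfl⟩
  | mul a b ha hb =>
    have : a * b - algebraMap k _ (SymmetricAlgebra.algebraMapInv (a * b)) =
        (a - algebraMap k _ (SymmetricAlgebra.algebraMapInv a)) * b +
        algebraMap k _ (SymmetricAlgebra.algebraMapInv a) *
          (b - algebraMap k _ (SymmetricAlgebra.algebraMapInv b)) := by
      rw [map_mul, map_mul]; ring
    rw [this]
    exact add_mem (Ideal.mul_mem_right _ _ ha) (Ideal.mul_mem_left _ _ hb)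
  | add a b ha hb =>
    rw [map_add, map_add, add_sub_add_comm]
    exact add_mem ha hb

theorem SymmetricAlgebra.algebraMapInv_eq_zero_of_mem {s : SymmetricAlgebra k V}
    (hs : s ∈ symMaxIdeal k V) : SymmetricAlgebra.algebraMapInv s = 0 := by
  have : symMaxIdeal k V ≤ RingHom.ker (SymmetricAlgebra.algebraMapInv (R := k) (M := V)) := by
    refine Ideal.span_le.2 ?_
    rintro _ ⟨v, rfl⟩
    exact SymmetricAlgebra.algebraMapInv_ι v
  exact this hs

theorem SymmetricAlgebra.one_notMem_symMaxIdeal : (1 : SymmetricAlgebra k V) ∉ symMaxIdeal k V :=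
  fun h => one_ne_zero ((map_one SymmetricAlgebra.algebraMapInv).symm.trans
    (algebraMapInv_eq_zero_of_mem h))

variable (G : Subgroup (LinearMap.GeneralLinearGroup k V))

theorem algebraMapInv_symAct (g : G) (s : SymmetricAlgebra k V) :
    SymmetricAlgebra.algebraMapInv (symAct G g s) = SymmetricAlgebra.algebraMapInv s := by
  have : (SymmetricAlgebra.algebraMapInv).comp (symAct G g) =
      (SymmetricAlgebra.algebraMapInv : SymmetricAlgebra k V →ₐ[k] k) := by
    apply SymmetricAlgebra.algHom_ext
    ext v
    simp [SymmetricAlgebra.algebraMapInv_ι]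
  exact congr($this s)

variable {J : Type*} (W : J → Type*) [∀ j, AddCommGroup (W j)] [∀ j, Module k (W j)]
variable (ρ : ∀ j, Representation k G (W j))

variable (k V) in
/-- The map `⨁ S ⊗ W_j → ⨁ W_j` setting all elements of `V` to zero. -/
def augmentation : (⨁ j, SymmetricAlgebra k V ⊗[k] W j) →ₗ[k] ⨁ j, W j :=
  DirectSum.lmap fun j => (TensorProduct.lid k (W j)).toLinearMap ∘ₗ
    (SymmetricAlgebra.algebraMapInv (R := k) (M := V)).toLinearMap.rTensor (W j)

variable (k V) in
/-- The inclusion `⨁ W_j → ⨁ S ⊗ W_j`. -/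
def augmentationSection : (⨁ j, W j) →ₗ[k] ⨁ j, SymmetricAlgebra k V ⊗[k] W j :=
  DirectSum.lmap fun j => TensorProduct.mk k (SymmetricAlgebra k V) (W j) 1

theorem symTensorSum_lof [DecidableEq J] (j : J) (s : SymmetricAlgebra k V) (w : W j) :
    DirectSum.lof (SymmetricAlgebra k V) J (fun j => SymmetricAlgebra k V ⊗[k] W j) j (s ⊗ₜ w) =
    s • DirectSum.lof (SymmetricAlgebra k V) J
      (fun j => SymmetricAlgebra k V ⊗[k] W j) j (1 ⊗ₜ w) := by
  rw [← map_smul, TensorProduct.smul_tmul', smul_eq_mul, mul_one]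

variable {W} in
-- The generators s (1 ⊗ w) keep the scalar s visible, so that S-linearity reduces claims to 1 ⊗ w.
theorem symTensorSum_induction [DecidableEq J]
    {P : (⨁ j, SymmetricAlgebra k V ⊗[k] W j) → Prop}
    (zero : P 0) (add : ∀ x y, P x → P y → P (x + y))
    (tmul : ∀ j (s : SymmetricAlgebra k V) (w : W j),
      P (s • DirectSum.lof (SymmetricAlgebra k V) J (fun j => SymmetricAlgebra k V ⊗[k] W j) j
        (1 ⊗ₜ w)))
    (x : ⨁ j, SymmetricAlgebra k V ⊗[k] W j) : P x := by
  induction x using DirectSum.induction_on with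
  | zero => exact zero
  | add x y hx hy => exact add x y hx hy
  | of j z =>
    induction z with
    | zero => rw [map_zero]; exact zero
    | add x y hx hy => rw [map_add]; exact add _ _ hx hy
    | tmul s w =>
      have := tmul j s w
      rwa [← symTensorSum_lof] at this

theorem augmentation_smul_lof [DecidableEq J] (j : J) (s : SymmetricAlgebra k V) (w : W j) :
    augmentation k V W (s • DirectSum.lof (SymmetricAlgebra k V) J
      (fun j => SymmetricAlgebra k V ⊗[k] W j) j (1 ⊗ₜ w)) =
    SymmetricAlgebra.algebraMapInv s • DirectSum.lof k J W j w := by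
  rw [← symTensorSum_lof, ← map_smul]
  exact DirectSum.lmap_lof _ _ _

theorem augmentation_smul (s : SymmetricAlgebra k V) (x : ⨁ j, SymmetricAlgebra k V ⊗[k] W j) :
    augmentation k V W (s • x) = SymmetricAlgebra.algebraMapInv s • augmentation k V W x := by
  classical
  induction x using symTensorSum_induction with
  | zero => simp
  | add x y hx hy => rw [smul_add, map_add, hx, hy, map_add, smul_add]
  | tmul j t w =>
    rw [smul_smul, augmentation_smul_lof, augmentation_smul_lof, map_mul, mul_smul]

theorem augmentation_augmentationSection (x : ⨁ j, W j) :
    augmentation k V W (augmentationSection k V W x) = x := by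
  classical
  induction x using DirectSum.induction_on with
  | zero => simp
  | add x y hx hy => rw [map_add, map_add, hx, hy]
  | of j w =>
    have : augmentationSection k V W (DirectSum.of W j w) =
      DirectSum.lof (SymmetricAlgebra k V) J
      (fun j => SymmetricAlgebra k V ⊗[k] W j) j (1 ⊗ₜ w) := DirectSum.lmap_lof _ _ _
    rw [this, ← one_smul (SymmetricAlgebra k V) (DirectSum.lof (SymmetricAlgebra k V) J
      (fun j => SymmetricAlgebra k V ⊗[k] W j) j _), augmentation_smul_lof, map_one, one_smul]
    rfl

theorem augmentation_surjective : Function.Surjective (augmentation k V W) :=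
  fun x => ⟨_, augmentation_augmentationSection W x⟩

/-- On s ⊗ w the error term is (s - s(0)) ⊗ w, with s(0) the constant term of s. This identifies the
kernel of the augmentation with 𝔪 times the module. -/
theorem exists_eq_add_augmentationSection (x : ⨁ j, SymmetricAlgebra k V ⊗[k] W j) :
    ∃ y ∈ (symMaxIdeal k V • ⊤ : Submodule (SymmetricAlgebra k V)
      (⨁ j, SymmetricAlgebra k V ⊗[k] W j)),
      x = y + augmentationSection k V W (augmentation k V W x) := by
  classical
  induction x using symTensorSum_induction with
  | zero => exact ⟨0, zero_mem _, by simp⟩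
  | add x y hx hy =>
    obtain ⟨x', hx', hx⟩ := hx
    obtain ⟨y', hy', hy⟩ := hy
    refine ⟨x' + y', add_mem hx' hy', ?_⟩
    rw [map_add, map_add, add_add_add_comm, ← hx, ← hy]
  | tmul j s w =>
    have : augmentationSection k V W (DirectSum.lof k J W j w) =
      DirectSum.lof (SymmetricAlgebra k V) J
      (fun j => SymmetricAlgebra k V ⊗[k] W j) j (1 ⊗ₜ w) := DirectSum.lmap_lof _ _ _
    refine ⟨_, Submodule.smul_mem_smul (SymmetricAlgebra.sub_algebraMap_mem_symMaxIdeal s)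
      (Submodule.mem_top (x := DirectSum.lof (SymmetricAlgebra k V) J
        (fun j => SymmetricAlgebra k V ⊗[k] W j) j (1 ⊗ₜ w))), ?_⟩
    rw [augmentation_smul_lof, map_smul, this, ← algebraMap_smul (SymmetricAlgebra k V)
      (SymmetricAlgebra.algebraMapInv s), ← add_smul, sub_add_cancel]

theorem augmentation_eq_zero_iff (x : ⨁ j, SymmetricAlgebra k V ⊗[k] W j) :
    augmentation k V W x = 0 ↔
      x ∈ (symMaxIdeal k V • ⊤ : Submodule (SymmetricAlgebra k V) _) := by
  refine ⟨fun h => ?_, fun h => ?_⟩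
  · obtain ⟨y, hy, hx⟩ := exists_eq_add_augmentationSection W x
    rw [h, map_zero, add_zero] at hx
    rwa [hx]
  · refine Submodule.smul_induction_on h (fun s hs y _ => ?_) (fun x y hx hy => ?_)
    · rw [augmentation_smul, SymmetricAlgebra.algebraMapInv_eq_zero_of_mem hs, zero_smul]
    · rw [map_add, hx, hy, add_zero]

/-- The `(G, S)`-module `⨁ S ⊗ W_j`. -/
abbrev symTensorSumRep : Representation k G (⨁ j, SymmetricAlgebra k V ⊗[k] W j) :=
  Representation.directSum fun j => symTensorRep G (ρ j)

variable {W}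

theorem symTensorSumRep_lof [DecidableEq J] (g : G) (j : J) (x : SymmetricAlgebra k V ⊗[k] W j) :
    symTensorSumRep G W ρ g (DirectSum.lof (SymmetricAlgebra k V) J
      (fun j => SymmetricAlgebra k V ⊗[k] W j) j x) =
    DirectSum.lof (SymmetricAlgebra k V) J
      (fun j => SymmetricAlgebra k V ⊗[k] W j) j (symTensorRep G (ρ j) g x) :=
  DirectSum.lmap_lof _ _ _

theorem isGSModule_symTensorSumRep : IsGSModule G (symTensorSumRep G W ρ) := by
  intro g s x
  refine DFinsupp.ext fun j => ?_
  exact isGSModule_symTensorRep G (ρ j) g s (x j)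

theorem augmentation_symTensorSumRep (g : G) (x : ⨁ j, SymmetricAlgebra k V ⊗[k] W j) :
    augmentation k V W (symTensorSumRep G W ρ g x) =
      Representation.directSum ρ g (augmentation k V W x) := by
  classical
  induction x using symTensorSum_induction with
  | zero => simp
  | add x y hx hy => simp only [map_add, hx, hy]
  | tmul j s w =>
    rw [isGSModule_symTensorSumRep, symTensorSumRep_lof, augmentation_smul, augmentation_smul,
      algebraMapInv_symAct, map_smul, Representation.tprod_apply, TensorProduct.map_tmul,
      symTensorSum_lof, augmentation_smul_lof, ← one_smul (SymmetricAlgebra k V)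
      (DirectSum.lof (SymmetricAlgebra k V) J (fun j => SymmetricAlgebra k V ⊗[k] W j) j _),
      augmentation_smul_lof, map_smul, symRep_apply, algebraMapInv_symAct]
    congr 2
    exact (DirectSum.lmap_lof (fun j => ρ j g) j w).symm

variable {G ρ} in
/-- A decomposition of the `(G, S)`-module `{}^e S` induces one of its fibre. -/
def GSEquiv.fibreEquiv {p e : ℕ} [ExpChar k p]
    (φ : GSEquiv G (frobSymRep G p e) (symTensorSumRep G W ρ)) :
    (frobFibreRep G p e).Equiv (Representation.directSum ρ) :=
  let ψ : FrobTwist p e (SymmetricAlgebra k V) →ₗ[k] ⨁ j, W j :=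
    augmentation k V W ∘ₗ φ.toLinearEquiv.toLinearMap.restrictScalars k
  -- An S-linear isomorphism carries 𝔪 {}^e S onto 𝔪 (⨁ S ⊗ W_j), the kernel of the augmentation.
  have hψ : (maxIdealFrobSym k V p e).restrictScalars k = LinearMap.ker ψ := by
    ext x
    rw [LinearMap.mem_ker, Submodule.restrictScalars_mem]
    change _ ↔ augmentation k V W (φ.toLinearEquiv x) = 0
    rw [augmentation_eq_zero_iff]
    have : (symMaxIdeal k V • ⊤ : Submodule (SymmetricAlgebra k V)
        (⨁ j, SymmetricAlgebra k V ⊗[k] W j)) =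
        (maxIdealFrobSym k V p e).map φ.toLinearEquiv.toLinearMap := by
      rw [maxIdealFrobSym, Submodule.map_smul'', Submodule.map_top, LinearEquiv.range]
    rw [this]
    exact ⟨fun h => ⟨x, h, rfl⟩, fun ⟨y, hy, hyx⟩ => φ.toLinearEquiv.injective hyx ▸ hy⟩
  have hs : Function.Surjective ψ := (augmentation_surjective W).comp φ.toLinearEquiv.surjective
  .mk ((Submodule.quotEquivOfEq _ _ hψ).trans (ψ.quotKerEquivOfSurjective hs)) fun g => by
    refine LinearMap.ext fun x => ?_
    obtain ⟨x, rfl⟩ := Submodule.Quotient.mk_surjective _ x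
    have := augmentation_symTensorSumRep G ρ g (φ.toLinearEquiv x)
    rw [← show φ.toLinearEquiv (frobSymRep G p e g x) = symTensorSumRep G W ρ g
      (φ.toLinearEquiv x) from φ.map_rep g x] at this
    exact this

end Fibre

/-! ### Maschke, Schur and homogeneous lifts -/

section FiniteGroupRepresentations

namespace Representation

variable {k Γ : Type*} [Field k] [Group Γ]

open scoped MonoidAlgebra in
theorem IsIrreducible.finiteDimensional [Finite Γ] {W : Type*} [AddCommGroup W] [Module k W]
    (ρ : Representation k Γ W) [ρ.IsIrreducible] : FiniteDimensional k W := by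
  have : Module.Finite k[Γ] ρ.asModule := inferInstance
  exact (Module.Finite.trans k[Γ] ρ.asModule : Module.Finite k ρ.asModule)

section Lift

variable {W T Q : Type*} [AddCommGroup W] [Module k W] [AddCommGroup T] [Module k T]
  [AddCommGroup Q] [Module k Q] {ρ : Representation k Γ W} {τ : Representation k Γ T}
  {κ : Representation k Γ Q}

/-- Maschke's theorem: over a finite group of invertible order, equivariant maps lift along
surjections. -/
theorem IntertwiningMap.exists_comp_eq_of_surjective [Finite Γ] (hΓ : (Nat.card Γ : k) ≠ 0)
    (π : IntertwiningMap τ κ) (hπ : Function.Surjective π) (f : IntertwiningMap ρ κ) :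
    ∃ h : IntertwiningMap ρ τ, π.comp h = f := by
  have := Fintype.ofFinite Γ
  obtain ⟨s, hs⟩ := π.toLinearMap.exists_rightInverse_of_surjective (LinearMap.range_eq_top.2 hπ)
  have hs' (x : Q) : π (s x) = x := congr($hs x)
  -- Averaging the linear lift s ∘ f over conjugation gives an equivariant map. Each conjugate still
  -- lifts f because π and f are equivariant.
  let ℓ : W →ₗ[k] T := (Nat.card Γ : k)⁻¹ • ∑ g : Γ, τ g ∘ₗ s ∘ₗ f.toLinearMap ∘ₗ ρ g⁻¹
  have hℓ (w : W) : ℓ w = (Nat.card Γ : k)⁻¹ • ∑ g : Γ, τ g (s (f (ρ g⁻¹ w))) := by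
    simp [ℓ, LinearMap.sum_apply]
  refine ⟨⟨ℓ, fun a => LinearMap.ext fun w => ?_⟩, ?_⟩
  · rw [LinearMap.comp_apply, LinearMap.comp_apply, hℓ, hℓ, map_smul, map_sum]
    congr 1
    refine (Fintype.sum_bijective (a * ·) (Group.mulLeft_bijective a) _ _ fun g => ?_).symm
    rw [mul_inv_rev, map_mul, map_mul, Module.End.mul_apply, Module.End.mul_apply,
      ← Module.End.mul_apply (ρ a⁻¹), ← map_mul, inv_mul_cancel, map_one, Module.End.one_apply]
  · refine IntertwiningMap.ext (LinearMap.ext fun w => ?_)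
    change π (ℓ w) = f w
    rw [hℓ, map_smul, map_sum]
    have (g : Γ) : π (τ g (s (f (ρ g⁻¹ w)))) = f w := by
      rw [IntertwiningMap.isIntertwining, hs', ← IntertwiningMap.isIntertwining,
        ← Module.End.mul_apply, ← map_mul, mul_inv_cancel, map_one, Module.End.one_apply]
    simp only [this, Finset.sum_const, Finset.card_univ, ← Nat.card_eq_fintype_card]
    rw [← Nat.cast_smul_eq_nsmul k, inv_smul_smul₀ hΓ]

/-- If `T` is graded, then the maps to a quotient of `T` that lift to homogeneous maps span. -/
theorem IntertwiningMap.span_homogeneous_eq_top [Finite Γ] (hΓ : (Nat.card Γ : k) ≠ 0)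
    [FiniteDimensional k W] (P : ℕ → T →ₗ[k] T) (hPτ : ∀ m g x, P m (τ g x) = τ g (P m x))
    (hPP : ∀ m x, P m (P m x) = P m x)
    (hP : ∀ x, ∃ N, ∀ n, N ≤ n → ∑ m ∈ Finset.range n, P m x = x)
    (π : IntertwiningMap τ κ) (hπ : Function.Surjective π) :
    Submodule.span k {f : IntertwiningMap ρ κ |
      ∃ (m : ℕ) (h : IntertwiningMap ρ τ), (∀ x, P m (h x) = h x) ∧ π.comp h = f} = ⊤ := by
  refine eq_top_iff.2 fun f _ => ?_
  obtain ⟨h, rfl⟩ := IntertwiningMap.exists_comp_eq_of_surjective hΓ π hπ f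
  choose N hN using hP
  let b := Module.finBasis k W
  -- As W is finite-dimensional, one bound serves for the degrees of all values of h.
  let n := Finset.univ.sup fun i => N (h (b i))
  have hn : ∑ m ∈ Finset.range n, P m ∘ₗ h.toLinearMap = h.toLinearMap := by
    refine b.ext fun i => ?_
    rw [LinearMap.sum_apply]
    exact hN _ n (Finset.le_sup (f := fun i => N (h (b i))) (Finset.mem_univ i))
  let hm (m : ℕ) : IntertwiningMap ρ τ := ⟨P m ∘ₗ h.toLinearMap, fun g => LinearMap.ext fun w => by
    change P m (h (ρ g w)) = τ g (P m (h w))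
    rw [IntertwiningMap.isIntertwining, hPτ]⟩
  have : π.comp h = ∑ m ∈ Finset.range n, π.comp (hm m) := by
    refine IntertwiningMap.ext (LinearMap.ext fun w => ?_)
    change π (h w) = (∑ m ∈ Finset.range n, π.comp (hm m)) w
    rw [IntertwiningMap.sum_apply]
    have hw : ∑ m ∈ Finset.range n, P m (h w) = h w := by
      simpa [LinearMap.sum_apply] using congr($hn w)
    conv_lhs => rw [← hw, map_sum]
    rfl
  rw [this]
  exact sum_mem fun m _ => Submodule.subset_span ⟨m, hm m, fun x => hPP m _, rfl⟩

end Lift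

variable {I : Type*} {W : I → Type*} [∀ i, AddCommGroup (W i)] [∀ i, Module k (W i)]

/-- The inclusion of a summand as an intertwining map. -/
def directSumLof [DecidableEq I] (ρ : ∀ i, Representation k Γ (W i)) (i : I) :
    IntertwiningMap (ρ i) (directSum ρ) :=
  ⟨DirectSum.lof k I W i, fun g => LinearMap.ext fun w =>
    (DirectSum.lmap_lof (fun i => ρ i g) i w).symm⟩

/-- The projection to a summand as an intertwining map. -/
def directSumComponent (ρ : ∀ i, Representation k Γ (W i)) (i : I) :
    IntertwiningMap (directSum ρ) (ρ i) :=
  ⟨DirectSum.component k I W i, fun _ => rfl⟩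

/-- By Schur's lemma a map from W_i is a scalar on each of the c_i copies of W_i and zero on the
other summands, so the space of maps is k ^ (c i). -/
theorem IntertwiningMap.finrank_directSum [IsAlgClosed k] [Finite Γ]
    (ρ : ∀ i, Representation k Γ (W i)) [∀ i, (ρ i).IsIrreducible]
    (hρ : ∀ i j, Nonempty ((ρ i).Equiv (ρ j)) → i = j) [Finite I] (c : I → ℕ) (i : I) :
    Module.finrank k
        (IntertwiningMap (ρ i) (directSum fun j : (i : I) × Fin (c i) => ρ j.1)) = c i ∧
      FiniteDimensional k
        (IntertwiningMap (ρ i) (directSum fun j : (i : I) × Fin (c i) => ρ j.1)) := by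
  classical
  have := Fintype.ofFinite I
  have (i : I) : FiniteDimensional k (W i) := IsIrreducible.finiteDimensional (ρ i)
  let ρ' (j : (i : I) × Fin (c i)) := ρ j.1
  let Λ : (Fin (c i) → k) →ₗ[k] IntertwiningMap (ρ i) (directSum ρ') :=
    Fintype.linearCombination k fun l => (directSumLof ρ' ⟨i, l⟩ : IntertwiningMap (ρ i) _)
  have hΛ (a : Fin (c i) → k) (w : W i) (l : Fin (c i)) : Λ a w ⟨i, l⟩ = a l • w := by
    rw [Fintype.linearCombination_apply, IntertwiningMap.sum_apply]
    change DirectSum.component k _ (fun j : (i : I) × Fin (c i) => W j.1) ⟨i, l⟩ _ = _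
    rw [map_sum, Finset.sum_eq_single l]
    · rw [IntertwiningMap.smul_apply, map_smul]
      congr 1
      exact DirectSum.component.lof_self _ _ _
    · intro l' _ hl'
      rw [IntertwiningMap.smul_apply, map_smul]
      convert smul_zero _
      refine (DirectSum.component.of _ _ _ _).trans (dif_neg fun h => hl' ?_)
      simpa using h
    · simp
  obtain ⟨w₀, hw₀⟩ : ∃ w : W i, w ≠ 0 := by
    by_contra! h
    have : Subsingleton (W i) := ⟨fun a b => (h a).trans (h b).symm⟩
    obtain ⟨A, B, hAB⟩ := (inferInstance : Nontrivial (Subrepresentation (ρ i)))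
    apply hAB
    ext x
    rw [Subsingleton.elim x 0]
    exact ⟨fun _ => B.toSubmodule.zero_mem, fun _ => A.toSubmodule.zero_mem⟩
  have hinj : Function.Injective Λ := by
    intro a b hab
    ext l
    have : a l • w₀ = b l • w₀ := by rw [← hΛ, ← hΛ, hab]
    exact smul_left_injective k hw₀ this
  have hsurj : Function.Surjective Λ := by
    intro f
    have hscal (l : Fin (c i)) : ∃ a : k, ∀ w, f w ⟨i, l⟩ = a • w := by
      let f' : IntertwiningMap (ρ i) (ρ i) := (directSumComponent ρ' ⟨i, l⟩).comp f
      obtain ⟨a, ha⟩ :=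
        (IsIrreducible.algebraMap_intertwiningMap_bijective_of_isAlgClosed (ρ := ρ i)).2 f'
      exact ⟨a, fun w => congr($ha w).symm⟩
    choose a ha using hscal
    refine ⟨a, IntertwiningMap.ext (LinearMap.ext fun w => DFinsupp.ext fun j => ?_)⟩
    obtain ⟨i', l⟩ := j
    by_cases hi : i = i'
    · subst hi
      exact (hΛ a w l).trans (ha l w).symm
    · have (f : IntertwiningMap (ρ i) (directSum ρ')) : f w ⟨i', l⟩ = 0 := by
        have h0 := (IsIrreducible.bijective_or_eq_zero
          ((directSumComponent ρ' ⟨i', l⟩).comp f)).resolve_left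
          fun h => hi (hρ i i' ⟨IntertwiningMap.ofBijective _ h⟩)
        exact congr($h0 w)
      exact (this _).trans (this f).symm
  let Λe := LinearEquiv.ofBijective Λ ⟨hinj, hsurj⟩
  exact ⟨by rw [← Λe.finrank_eq, Module.finrank_fin_fun], Module.Finite.equiv Λe⟩

/-- If a quotient `Q` of a graded representation `T` is a direct sum of irreducible
representations, then such a decomposition can be lifted to homogeneous maps to `T`. -/
theorem exists_homogeneous_lift [IsAlgClosed k] [Finite Γ] (hΓ : (Nat.card Γ : k) ≠ 0)
    (ρ : ∀ i, Representation k Γ (W i)) [∀ i, (ρ i).IsIrreducible]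
    (hρ : ∀ i j, Nonempty ((ρ i).Equiv (ρ j)) → i = j) [Finite I] (c : I → ℕ)
    {T Q : Type*} [AddCommGroup T] [Module k T] [AddCommGroup Q] [Module k Q]
    {τ : Representation k Γ T} {κ : Representation k Γ Q}
    (P : ℕ → T →ₗ[k] T) (hPτ : ∀ m g x, P m (τ g x) = τ g (P m x))
    (hPP : ∀ m x, P m (P m x) = P m x)
    (hP : ∀ x, ∃ N, ∀ n, N ≤ n → ∑ m ∈ Finset.range n, P m x = x)
    (π : IntertwiningMap τ κ) (hπ : Function.Surjective π)
    (θ : κ.Equiv (directSum fun j : (i : I) × Fin (c i) => ρ j.1))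
    [DecidableEq ((i : I) × Fin (c i))] :
    ∃ (d : (i : I) × Fin (c i) → ℕ) (h : ∀ j, IntertwiningMap (ρ j.1) τ),
      (∀ j x, P (d j) (h j x) = h j x) ∧
      Function.Bijective (DirectSum.toModule k ((i : I) × Fin (c i)) Q
        fun j => (π.comp (h j)).toLinearMap) := by
  have := Fintype.ofFinite I
  have (i : I) : FiniteDimensional k (W i) := IsIrreducible.finiteDimensional (ρ i)
  have key (i : I) : ∃ (d : Fin (c i) → ℕ) (h : Fin (c i) → IntertwiningMap (ρ i) τ),
      (∀ l x, P (d l) (h l x) = h l x) ∧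
      Submodule.span k (Set.range fun l => π.comp (h l)) = ⊤ := by
    -- The maps with homogeneous lifts span, so a basis can be chosen among them; θ and the Schur
    -- count show that it has c i elements.
    obtain ⟨b, hb, hspan, hli⟩ := exists_linearIndependent k {f : IntertwiningMap (ρ i) κ |
      ∃ (m : ℕ) (h : IntertwiningMap (ρ i) τ), (∀ x, P m (h x) = h x) ∧ π.comp h = f}
    rw [IntertwiningMap.span_homogeneous_eq_top hΓ P hPτ hPP hP π hπ] at hspan
    let B := Module.Basis.mk hli (by rw [Subtype.range_coe, hspan])
    let E : IntertwiningMap (ρ i) κ ≃ₗ[k]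
        IntertwiningMap (ρ i) (directSum fun j : (i : I) × Fin (c i) => ρ j.1) :=
      { toFun := fun f => θ.toIntertwiningMap.comp f
        invFun := fun f => θ.symm.toIntertwiningMap.comp f
        map_add' := fun f g => IntertwiningMap.ext (LinearMap.ext fun x => map_add θ (f x) (g x))
        map_smul' := fun a f => IntertwiningMap.ext (LinearMap.ext fun x => map_smul θ a (f x))
        left_inv := fun f => IntertwiningMap.ext (LinearMap.ext fun x => θ.symm_apply_apply (f x))
        right_inv := fun f =>
          IntertwiningMap.ext (LinearMap.ext fun x => θ.apply_symm_apply (f x)) }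
    obtain ⟨hfr, hfd⟩ := IntertwiningMap.finrank_directSum ρ hρ c i
    have : FiniteDimensional k (IntertwiningMap (ρ i) κ) := Module.Finite.equiv E.symm
    have hfin : Finite b := Module.Finite.finite_basis B
    have hcard : Nat.card b = c i := by
      rw [← Module.finrank_eq_nat_card_basis B, E.finrank_eq, hfr]
    let ε : Fin (c i) ≃ b := (finCongr hcard.symm).trans (Finite.equivFin b).symm
    choose m h hh hπh using fun l => hb (ε l).2
    refine ⟨m, h, hh, ?_⟩
    rw [← hspan]
    congr 1
    ext f
    refine ⟨?_, fun hf => ⟨ε.symm ⟨f, hf⟩, ?_⟩⟩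
    · rintro ⟨l, rfl⟩
      dsimp only
      rw [hπh]
      exact (ε l).2
    · dsimp only
      rw [hπh]
      exact congr_arg Subtype.val (ε.apply_symm_apply ⟨f, hf⟩)
  choose d h hd hspan using key
  refine ⟨fun j => d j.1 j.2, fun j => h j.1 j.2, fun j x => hd j.1 j.2 x, ?_⟩
  set Θ := DirectSum.toModule k ((i : I) × Fin (c i)) Q
        fun j => (π.comp (h j.1 j.2)).toLinearMap with hΘ
  have hmem (i : I) (f : IntertwiningMap (ρ i) κ) (x : W i) : f x ∈ LinearMap.range Θ := by
    have hf : f ∈ Submodule.span k (Set.range fun l => π.comp (h i l)) := by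
      rw [hspan]; trivial
    induction hf using Submodule.span_induction with
    | mem f hf =>
      obtain ⟨l, rfl⟩ := hf
      exact ⟨DirectSum.lof k ((i : I) × Fin (c i)) (fun j => W j.1) ⟨i, l⟩ x,
        DirectSum.toModule_lof _ _ _⟩
    | zero => exact zero_mem _
    | add f g _ _ hf hg => exact add_mem hf hg
    | smul a f _ hf => exact Submodule.smul_mem _ a hf
  have hsurj : Function.Surjective Θ := by
    intro q
    rw [← LinearMap.mem_range, ← θ.symm_apply_apply q]
    induction θ q using DirectSum.induction_on with
    | zero => rw [map_zero]; exact zero_mem _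
    | add x y hx hy => rw [map_add]; exact add_mem hx hy
    | of j x =>
      have := hmem j.1 (θ.symm.toIntertwiningMap.comp
        (directSumLof (fun j : (i : I) × Fin (c i) => ρ j.1) j)) x
      exact this
  have : FiniteDimensional k (⨁ j : (i : I) × Fin (c i), W j.1) :=
    Module.Finite.equiv (DirectSum.linearEquivFunOnFintype k ((i : I) × Fin (c i))
      (fun j => W j.1)).symm
  have : FiniteDimensional k Q := Module.Finite.equiv θ.symm.toLinearEquiv
  -- Both sides have the same finite dimension by θ, so surjectivity suffices.
  exact ⟨(LinearMap.injective_iff_surjective_of_finrank_eq_finrank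
    θ.toLinearEquiv.finrank_eq.symm).2 hsurj, hsurj⟩

end Representation

end FiniteGroupRepresentations

/-- Nakayama's lemma: a surjection from a finitely generated torsion-free module onto a projective
module is injective if its kernel becomes zero modulo a proper ideal. -/
theorem LinearMap.injective_of_ker_le_smul_top {A F T : Type*} [CommRing A] [IsDomain A]
    [AddCommMonoid F] [Module A F] [Module.Finite A F] [Module.IsTorsionFree A F]
    [AddCommGroup T] [Module A T] [Module.Projective A T] {I : Ideal A} (hI : 1 ∉ I)
    {Ψ : F →ₗ[A] T} (hΨ : Function.Surjective Ψ) (hker : LinearMap.ker Ψ ≤ I • ⊤) :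
    Function.Injective Ψ := by
  let _ : AddCommGroup F := Module.addCommMonoidToAddCommGroup A
  obtain ⟨s, hs⟩ := Module.projective_lifting_property Ψ LinearMap.id hΨ
  let r : F →ₗ[A] F := LinearMap.id - s ∘ₗ Ψ
  have hr (x : F) : r x ∈ LinearMap.ker Ψ := by
    have := congr($hs (Ψ x))
    rw [LinearMap.mem_ker, LinearMap.sub_apply, map_sub, sub_eq_zero]
    exact this.symm
  have hr' {x : F} (hx : x ∈ LinearMap.ker Ψ) : r x = x := by
    simp [r, LinearMap.mem_ker.1 hx]
  have hrange : LinearMap.range r = LinearMap.ker Ψ :=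
    le_antisymm (by rintro _ ⟨x, rfl⟩; exact hr x) fun x hx => ⟨x, hr' hx⟩
  -- The retraction r onto the kernel sends I F into I times the kernel and fixes the kernel. So
  -- some a congruent to 1 modulo I kills the kernel, and a ≠ 0 since I is proper.
  have hle : LinearMap.ker Ψ ≤ I • LinearMap.ker Ψ := by
    intro x hx
    have h1 : r x ∈ (I • (⊤ : Submodule A F)).map r := ⟨x, hker hx, rfl⟩
    rwa [Submodule.map_smul'', Submodule.map_top, hrange, hr' hx] at h1
  obtain ⟨a, ha, ha0⟩ := Submodule.exists_sub_one_mem_and_smul_eq_zero_of_fg_of_le_smul I _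
    (by rw [← hrange, ← Submodule.map_top]; exact Module.Finite.fg_top.map r) hle
  have hane : a ≠ 0 := by
    rintro rfl
    exact hI (by simpa using ha)
  rw [← LinearMap.ker_eq_bot, eq_bot_iff]
  exact fun x hx => (smul_eq_zero.1 (ha0 x hx)).resolve_left hane

/-! ### The (1/q)ℤ-grading of {}^e S and its fibre -/

section FrobeniusGrading

variable {k V : Type*} [Field k] [AddCommGroup V] [Module k V]
variable (G : Subgroup (LinearMap.GeneralLinearGroup k V))

variable (k V) in
/-- The projection of `S` to its part of degree `n`. -/
def symComponent (n : ℕ) : SymmetricAlgebra k V →ₗ[k] SymmetricAlgebra k V :=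
  GradedAlgebra.proj (fun n : ℕ => LinearMap.range (SymmetricAlgebra.ι k V) ^ n) n

theorem symComponent_mem (n : ℕ) (x : SymmetricAlgebra k V) :
    symComponent k V n x ∈ LinearMap.range (SymmetricAlgebra.ι k V) ^ n :=
  SetLike.coe_mem _

theorem symComponent_of_mem {n : ℕ} {x : SymmetricAlgebra k V}
    (hx : x ∈ LinearMap.range (SymmetricAlgebra.ι k V) ^ n) : symComponent k V n x = x :=
  DirectSum.decompose_of_mem_same
    (fun n : ℕ => LinearMap.range (SymmetricAlgebra.ι k V) ^ n) hx

theorem symComponent_of_mem_ne {m n : ℕ} {x : SymmetricAlgebra k V}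
    (hx : x ∈ LinearMap.range (SymmetricAlgebra.ι k V) ^ m) (hmn : m ≠ n) :
    symComponent k V n x = 0 :=
  DirectSum.decompose_of_mem_ne
    (fun n : ℕ => LinearMap.range (SymmetricAlgebra.ι k V) ^ n) hx hmn

theorem symPower_induction {P : SymmetricAlgebra k V → Prop} (zero : P 0)
    (homogeneous : ∀ (n : ℕ) (x), x ∈ LinearMap.range (SymmetricAlgebra.ι k V) ^ n → P x)
    (add : ∀ x y, P x → P y → P (x + y)) (x : SymmetricAlgebra k V) : P x :=
  DirectSum.Decomposition.inductionOn
    (fun n : ℕ => LinearMap.range (SymmetricAlgebra.ι k V) ^ n) zero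
    (fun {n} m => homogeneous n m m.2) add x

theorem exists_sum_symComponent (x : SymmetricAlgebra k V) :
    ∃ N, ∀ n, N ≤ n → ∑ m ∈ Finset.range n, symComponent k V m x = x := by
  induction x using symPower_induction with
  | zero => exact ⟨0, fun n _ => by simp⟩
  | homogeneous a x hx =>
    refine ⟨a + 1, fun n hn => ?_⟩
    rw [Finset.sum_eq_single a, symComponent_of_mem hx]
    · exact fun m _ hm => symComponent_of_mem_ne hx hm.symm
    · exact fun ha => absurd (Finset.mem_range.2 hn) ha
  | add x y hx hy =>
    obtain ⟨N, hN⟩ := hx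
    obtain ⟨N', hN'⟩ := hy
    refine ⟨max N N', fun n hn => ?_⟩
    simp only [map_add, Finset.sum_add_distrib]
    rw [hN n (le_of_max_le_left hn), hN' n (le_of_max_le_right hn)]

theorem symComponent_symAct (g : G) (n : ℕ) (x : SymmetricAlgebra k V) :
    symComponent k V n (symAct G g x) = symAct G g (symComponent k V n x) := by
  induction x using symPower_induction with
  | zero => simp
  | homogeneous a x hx =>
    by_cases h : a = n
    · subst h
      rw [symComponent_of_mem hx, symComponent_of_mem (symAct_mem_range_pow G g hx)]
    · rw [symComponent_of_mem_ne hx h, symComponent_of_mem_ne (symAct_mem_range_pow G g hx) h,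
        map_zero]
  | add x y hx hy => simp only [map_add, hx, hy]

theorem pow_mem_symPiece {t : ℚ} {x : SymmetricAlgebra k V} (hx : x ∈ symPiece k V t) (n : ℕ) :
    x ^ n ∈ symPiece k V (n * t) := by
  induction n with
  | zero =>
    have := symPiece_natCast (k := k) (V := V) 0
    rw [pow_zero, Nat.cast_zero] at this
    rw [pow_zero, Nat.cast_zero, zero_mul, this]
    exact Submodule.one_le.1 le_rfl
  | succ n ih =>
    rw [pow_succ, Nat.cast_succ, add_mul, one_mul]
    exact mul_mem_symPiece ih hx

variable {p e : ℕ} [ExpChar k p]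

variable (k V p e) in
/-- The projection of `{}^e S` to its part of degree `n / q`. -/
def frobComponent (n : ℕ) : FrobTwist p e (SymmetricAlgebra k V) →ₗ[k]
    FrobTwist p e (SymmetricAlgebra k V) where
  toFun x := FrobTwist.of p e _ (symComponent k V n ((FrobTwist.of p e _).symm x))
  map_add' x y := by rw [map_add, map_add, map_add]
  map_smul' a x := by
    obtain ⟨x, rfl⟩ := (FrobTwist.of p e _).surjective x
    rw [RingHom.id_apply, FrobTwist.smul_of, AddEquiv.symm_apply_apply, map_smul,
      AddEquiv.symm_apply_apply, FrobTwist.smul_of]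

theorem frobComponent_of (n : ℕ) (x : SymmetricAlgebra k V) :
    frobComponent k V p e n (FrobTwist.of p e _ x) = FrobTwist.of p e _ (symComponent k V n x) :=
  rfl

theorem cast_expChar_pow_ne_zero (k : Type*) [Field k] (p e : ℕ) [ExpChar k p] :
    ((p : ℚ) ^ e) ≠ 0 :=
  pow_ne_zero e (Nat.cast_ne_zero.2 (expChar_pos k p).ne')

theorem mem_twistPiece_div_iff {n : ℕ} {x : FrobTwist p e (SymmetricAlgebra k V)} :
    x ∈ twistPiece p e (symPiece k V) (n / (p : ℚ) ^ e) ↔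
      (FrobTwist.of p e _).symm x ∈ LinearMap.range (SymmetricAlgebra.ι k V) ^ n := by
  have h : (p : ℚ) ^ e * (n / (p : ℚ) ^ e) = n :=
    mul_div_cancel₀ _ (cast_expChar_pow_ne_zero k p e)
  change (FrobTwist.of p e _).symm x ∈ symPiece k V ((p : ℚ) ^ e * (n / (p : ℚ) ^ e)) ↔ _
  rw [h, symPiece_natCast]

theorem frobComponent_eq_self_iff {n : ℕ} {x : FrobTwist p e (SymmetricAlgebra k V)} :
    frobComponent k V p e n x = x ↔ x ∈ twistPiece p e (symPiece k V) (n / (p : ℚ) ^ e) := by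
  rw [mem_twistPiece_div_iff]
  refine ⟨fun h => ?_, fun h => congrArg (FrobTwist.of p e _) (symComponent_of_mem h)⟩
  rw [← h]
  exact symComponent_mem n _

theorem frobComponent_mem (n : ℕ) (x : FrobTwist p e (SymmetricAlgebra k V)) :
    frobComponent k V p e n x ∈ twistPiece p e (symPiece k V) (n / (p : ℚ) ^ e) :=
  mem_twistPiece_div_iff.2 (symComponent_mem n _)

theorem frobComponent_of_mem_ne {m n : ℕ} {x : FrobTwist p e (SymmetricAlgebra k V)}
    (hx : x ∈ twistPiece p e (symPiece k V) (m / (p : ℚ) ^ e)) (hmn : m ≠ n) :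
    frobComponent k V p e n x = 0 := by
  rw [mem_twistPiece_div_iff] at hx
  exact (congrArg (FrobTwist.of p e _) (symComponent_of_mem_ne hx hmn)).trans (map_zero _)

theorem exists_sum_frobComponent (x : FrobTwist p e (SymmetricAlgebra k V)) :
    ∃ N, ∀ n, N ≤ n → ∑ m ∈ Finset.range n, frobComponent k V p e m x = x := by
  obtain ⟨x, rfl⟩ := (FrobTwist.of p e _).surjective x
  obtain ⟨N, hN⟩ := exists_sum_symComponent x
  refine ⟨N, fun n hn => ?_⟩
  simp only [frobComponent_of]
  rw [← map_sum, hN n hn]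

theorem frobComponent_frobSymRep (n : ℕ) (g : G) (x : FrobTwist p e (SymmetricAlgebra k V)) :
    frobComponent k V p e n (frobSymRep G p e g x) =
      frobSymRep G p e g (frobComponent k V p e n x) := by
  obtain ⟨x, rfl⟩ := (FrobTwist.of p e _).surjective x
  exact congrArg (FrobTwist.of p e _) (symComponent_symAct G g n x)

theorem smul_mem_twistPiece {s : SymmetricAlgebra k V} {a t : ℚ} (hs : s ∈ symPiece k V a)
    {x : FrobTwist p e (SymmetricAlgebra k V)} (hx : x ∈ twistPiece p e (symPiece k V) t) :
    s • x ∈ twistPiece p e (symPiece k V) (a + t) := by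
  have := mul_mem_symPiece (pow_mem_symPiece hs (p ^ e)) hx
  rw [Nat.cast_pow, ← mul_add] at this
  exact this

/-- Scalars act through q-th powers, so degree a in S adds q a to the numerator n of the degree n /
q. -/
theorem smul_mem_twistPiece_div {s : SymmetricAlgebra k V} {a n : ℕ}
    (hs : s ∈ LinearMap.range (SymmetricAlgebra.ι k V) ^ a)
    {x : FrobTwist p e (SymmetricAlgebra k V)}
    (hx : x ∈ twistPiece p e (symPiece k V) (n / (p : ℚ) ^ e)) :
    s • x ∈ twistPiece p e (symPiece k V) ((p ^ e * a + n : ℕ) / (p : ℚ) ^ e) := by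
  rw [← symPiece_natCast] at hs
  have h0 := cast_expChar_pow_ne_zero k p e
  have : ((p ^ e * a + n : ℕ) / (p : ℚ) ^ e) = a + n / (p : ℚ) ^ e := by
    push_cast
    field_simp
  rw [this]
  exact smul_mem_twistPiece hs hx

theorem twistPiece_symPiece_eq_bot_of_neg {t : ℚ} (ht : t < 0) :
    twistPiece p e (symPiece k V) t = ⊥ := by
  have hq : (0 : ℚ) < (p : ℚ) ^ e := pow_pos (Nat.cast_pos.2 (expChar_pos k p)) e
  refine eq_bot_iff.2 fun x hx => ?_
  change _ ∈ symPiece k V _ at hx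
  rw [symPiece_eq_bot fun n hn => (not_lt.2 (Nat.cast_nonneg (α := ℚ) n))
    (hn.trans_lt (mul_neg_of_pos_of_neg hq ht))] at hx
  exact hx

theorem mem_fracDegrees_iff {t : ℚ} : t ∈ fracDegrees p e ↔ ∃ z : ℤ, z / (p : ℚ) ^ e = t := by
  rw [fracDegrees, AddSubgroup.mem_zmultiples_iff]
  simp only [zsmul_eq_mul, mul_one_div]

/-- The projection of `{}^e S` to its fibre. -/
def frobFibreProj (p e : ℕ) [ExpChar k p] :
    Representation.IntertwiningMap (frobSymRep G p e) (frobFibreRep G p e) :=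
  ⟨((maxIdealFrobSym k V p e).restrictScalars k).mkQ, fun _ => rfl⟩

theorem frobFibreProj_surjective : Function.Surjective (frobFibreProj G p e) :=
  Submodule.Quotient.mk_surjective _

theorem frobFibreProj_eq_zero_iff (x : FrobTwist p e (SymmetricAlgebra k V)) :
    frobFibreProj G p e x = 0 ↔ x ∈ maxIdealFrobSym k V p e :=
  Submodule.Quotient.mk_eq_zero _

theorem frobFibreProj_smul (s : SymmetricAlgebra k V) (x : FrobTwist p e (SymmetricAlgebra k V)) :
    frobFibreProj G p e (s • x) =
      SymmetricAlgebra.algebraMapInv s • frobFibreProj G p e x := by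
  have h : s • x = (s - algebraMap k _ (SymmetricAlgebra.algebraMapInv s)) • x +
      SymmetricAlgebra.algebraMapInv s • x := by
    rw [← algebraMap_smul (SymmetricAlgebra k V) (SymmetricAlgebra.algebraMapInv s), ← add_smul,
      sub_add_cancel]
  have h0 : frobFibreProj G p e
      ((s - algebraMap k _ (SymmetricAlgebra.algebraMapInv s)) • x) = 0 :=
    (frobFibreProj_eq_zero_iff G _).2
      (Submodule.smul_mem_smul (SymmetricAlgebra.sub_algebraMap_mem_symMaxIdeal s) trivial)
  rw [h, map_add, h0, zero_add, map_smul]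

end FrobeniusGrading

/-! ### Lifting a decomposition of the fibre -/

section LiftedDecomposition

variable {k V : Type*} [Field k] [AddCommGroup V] [Module k V]
variable (G : Subgroup (LinearMap.GeneralLinearGroup k V))
variable {J : Type*} {W : J → Type*} [∀ j, AddCommGroup (W j)] [∀ j, Module k (W j)]
variable {ρ : ∀ j, Representation k G (W j)}

instance [∀ j, FiniteDimensional k (W j)] [Finite J] :
    Module.Finite (SymmetricAlgebra k V) (⨁ j, SymmetricAlgebra k V ⊗[k] W j) :=
  have := Fintype.ofFinite J
  have := Classical.decEq J
  Module.Finite.equiv (DirectSum.linearEquivFunOnFintype (SymmetricAlgebra k V) J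
    (fun j => SymmetricAlgebra k V ⊗[k] W j)).symm

theorem tmul_mem_symTensorPiece {U : Type*} [AddCommGroup U] [Module k U] {t : ℚ}
    {s : SymmetricAlgebra k V} (hs : s ∈ symPiece k V t) (u : U) :
    s ⊗ₜ u ∈ symTensorPiece k V U t :=
  ⟨(⟨s, hs⟩ : symPiece k V t) ⊗ₜ u, rfl⟩

variable {p e : ℕ} [ExpChar k p] [DecidableEq J]

/-- The `S`-linear map `⨁ S ⊗ W_j → {}^e S` extending linear maps on the `W_j`. -/
def symTensorSumLift (h : ∀ j, W j →ₗ[k] FrobTwist p e (SymmetricAlgebra k V)) :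
    (⨁ j, SymmetricAlgebra k V ⊗[k] W j) →ₗ[SymmetricAlgebra k V]
      FrobTwist p e (SymmetricAlgebra k V) :=
  DirectSum.toModule (SymmetricAlgebra k V) J _
    fun j => (h j).liftBaseChange (SymmetricAlgebra k V)

theorem symTensorSumLift_lof (h : ∀ j, W j →ₗ[k] FrobTwist p e (SymmetricAlgebra k V)) (j : J)
    (s : SymmetricAlgebra k V) (w : W j) :
    symTensorSumLift h (DirectSum.lof (SymmetricAlgebra k V) J
      (fun j => SymmetricAlgebra k V ⊗[k] W j) j (s ⊗ₜ w)) = s • h j w := by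
  rw [symTensorSumLift, DirectSum.toModule_lof, LinearMap.liftBaseChange_tmul]

variable {h : ∀ j, Representation.IntertwiningMap (ρ j) (frobSymRep G p e)}

theorem symTensorSumLift_rep (g : G) (x : ⨁ j, SymmetricAlgebra k V ⊗[k] W j) :
    symTensorSumLift (fun j => (h j).toLinearMap) (symTensorSumRep G W ρ g x) =
      frobSymRep G p e g (symTensorSumLift (fun j => (h j).toLinearMap) x) := by
  induction x using symTensorSum_induction with
  | zero => simp
  | add x y hx hy => simp only [map_add, hx, hy]
  | tmul j s w =>
    rw [isGSModule_symTensorSumRep, symTensorSumRep_lof, Representation.tprod_apply,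
      TensorProduct.map_tmul, ← map_smul (DirectSum.lof (SymmetricAlgebra k V) J
        (fun j => SymmetricAlgebra k V ⊗[k] W j) j),
      ← map_smul (DirectSum.lof (SymmetricAlgebra k V) J
        (fun j => SymmetricAlgebra k V ⊗[k] W j) j), TensorProduct.smul_tmul',
      TensorProduct.smul_tmul', symTensorSumLift_lof, symTensorSumLift_lof,
      isGSModule_frobSymRep]
    simp [Representation.IntertwiningMap.isIntertwining]

theorem frobFibreProj_symTensorSumLift (x : ⨁ j, SymmetricAlgebra k V ⊗[k] W j) :
    frobFibreProj G p e (symTensorSumLift (fun j => (h j).toLinearMap) x) =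
      DirectSum.toModule k J _ (fun j => ((frobFibreProj G p e).comp (h j)).toLinearMap)
        (augmentation k V W x) := by
  induction x using symTensorSum_induction with
  | zero => simp
  | add x y hx hy => simp only [map_add, hx, hy]
  | tmul j s w =>
    rw [augmentation_smul_lof, ← symTensorSum_lof, symTensorSumLift_lof, frobFibreProj_smul,
      map_smul, DirectSum.toModule_lof]
    rfl

variable {d : J → ℕ}

theorem symTensorSumLift_mem
    (hd : ∀ j w, h j w ∈ twistPiece p e (symPiece k V) (d j / (p : ℚ) ^ e)) (t : ℚ)
    {x : ⨁ j, SymmetricAlgebra k V ⊗[k] W j}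
    (hx : x ∈ shiftSumPiece (fun j => symTensorPiece k V (W j)) (fun j => d j / (p : ℚ) ^ e) t) :
    symTensorSumLift (fun j => (h j).toLinearMap) x ∈ twistPiece p e (symPiece k V) t := by
  classical
  rw [← DirectSum.sum_support_of x, map_sum]
  refine sum_mem fun j _ => ?_
  obtain ⟨z, hz⟩ := hx j
  rw [← hz]
  clear hz
  induction z with
  | zero => simp
  | add y z hy hz => simp only [map_add]; exact add_mem hy hz
  | tmul s w =>
    have := smul_mem_twistPiece s.2 (hd j w)
    rw [sub_add_cancel] at this
    have h1 := symTensorSumLift_lof (fun j => (h j).toLinearMap) j s.1 w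
    exact h1 ▸ this

/-- For s homogeneous of degree a, the image of s ⊗ w has degree (q a + d_j) / q, so y is either s ⊗
w or 0. Once the lift is known to be injective, this shows that its inverse also preserves degrees.
-/
theorem exists_symTensorSumLift_eq_frobComponent
    (hd : ∀ j w, h j w ∈ twistPiece p e (symPiece k V) (d j / (p : ℚ) ^ e)) (n : ℕ)
    (x : ⨁ j, SymmetricAlgebra k V ⊗[k] W j) :
    ∃ y ∈ shiftSumPiece (fun j => symTensorPiece k V (W j)) (fun j => d j / (p : ℚ) ^ e)
        (n / (p : ℚ) ^ e),
      symTensorSumLift (fun j => (h j).toLinearMap) y =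
        frobComponent k V p e n (symTensorSumLift (fun j => (h j).toLinearMap) x) := by
  induction x using symTensorSum_induction with
  | zero => exact ⟨0, zero_mem _, by simp⟩
  | add x y hx hy =>
    obtain ⟨x', hx', hx⟩ := hx
    obtain ⟨y', hy', hy⟩ := hy
    exact ⟨x' + y', add_mem hx' hy', by simp only [map_add, hx, hy]⟩
  | tmul j s w =>
    induction s using symPower_induction with
    | zero => exact ⟨0, zero_mem _, by simp⟩
    | add x y hx hy =>
      obtain ⟨x', hx', hx⟩ := hx
      obtain ⟨y', hy', hy⟩ := hy
      exact ⟨x' + y', add_mem hx' hy', by simp only [map_add, add_smul, hx, hy]⟩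
    | homogeneous a s hs =>
      rw [← symTensorSum_lof, symTensorSumLift_lof]
      have hmem := smul_mem_twistPiece_div hs (hd j w)
      by_cases hn : p ^ e * a + d j = n
      · refine ⟨DirectSum.lof (SymmetricAlgebra k V) J
          (fun j => SymmetricAlgebra k V ⊗[k] W j) j (s ⊗ₜ w), fun j' => ?_, ?_⟩
        · by_cases hj : j = j'
          · subst hj
            rw [show DirectSum.lof (SymmetricAlgebra k V) J
              (fun j => SymmetricAlgebra k V ⊗[k] W j) j (s ⊗ₜ w) j = s ⊗ₜ w from
              DirectSum.of_eq_same _ _]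
            refine tmul_mem_symTensorPiece ?_ w
            have h0 := cast_expChar_pow_ne_zero k p e
            have : (n / (p : ℚ) ^ e - d j / (p : ℚ) ^ e) = a := by
              rw [← hn]
              push_cast
              field_simp
              ring
            rw [this, symPiece_natCast]
            exact hs
          · rw [show DirectSum.lof (SymmetricAlgebra k V) J
              (fun j => SymmetricAlgebra k V ⊗[k] W j) j (s ⊗ₜ w) j' = 0 from
              DirectSum.of_eq_of_ne _ _ _ (Ne.symm hj)]
            exact zero_mem _
        · rw [symTensorSumLift_lof]
          rw [hn] at hmem
          exact (frobComponent_eq_self_iff.2 hmem).symm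
      · exact ⟨0, zero_mem _, by rw [map_zero]; exact (frobComponent_of_mem_ne hmem hn).symm⟩

/-- Graded Nakayama, by strong induction on the numerator n of the degree. A homogeneous element
lies in the image modulo 𝔪 {}^e S, and the degree n / q part of 𝔪 {}^e S comes from V times elements
of smaller degree. -/
theorem symTensorSumLift_surjective
    (hd : ∀ j w, h j w ∈ twistPiece p e (symPiece k V) (d j / (p : ℚ) ^ e))
    (hΘ : Function.Surjective (DirectSum.toModule k J _
      (fun j => ((frobFibreProj G p e).comp (h j)).toLinearMap))) :
    Function.Surjective (symTensorSumLift (fun j => (h j).toLinearMap)) := by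
  set Ψ := symTensorSumLift (fun j => (h j).toLinearMap) with hΨ
  have hhom (n : ℕ) : ∀ x ∈ twistPiece p e (symPiece k V) (n / (p : ℚ) ^ e),
      x ∈ LinearMap.range Ψ := by
    induction n using Nat.strong_induction_on with
    | _ n ih =>
      -- The quantification over all x absorbs coefficients: (a s) x = s (a x). This reduces to s in
      -- V, which raises numerators by q > 0.
      have hmax (s : SymmetricAlgebra k V) (hs : s ∈ symMaxIdeal k V) :
          ∀ x, frobComponent k V p e n (s • x) ∈ LinearMap.range Ψ := by
        induction hs using Submodule.span_induction with
        | mem s hs =>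
          obtain ⟨v, rfl⟩ := hs
          intro x
          obtain ⟨N, hN⟩ := exists_sum_frobComponent x
          rw [← hN N le_rfl, Finset.smul_sum, map_sum]
          refine sum_mem fun m _ => ?_
          have hv : SymmetricAlgebra.ι k V v ∈ LinearMap.range (SymmetricAlgebra.ι k V) ^ 1 := by
            rw [pow_one]
            exact ⟨v, rfl⟩
          have hmem := smul_mem_twistPiece_div hv (frobComponent_mem m x)
          by_cases hm : p ^ e * 1 + m = n
          · rw [hm] at hmem
            rw [frobComponent_eq_self_iff.2 hmem]
            refine Submodule.smul_mem _ _ (ih m ?_ _ (frobComponent_mem m x))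
            have := expChar_pow_pos k p e
            omega
          · rw [frobComponent_of_mem_ne hmem hm]
            exact zero_mem _
        | zero => intro x; rw [zero_smul, map_zero]; exact zero_mem _
        | add s t _ _ hs ht =>
          intro x
          rw [add_smul, map_add]
          exact add_mem (hs x) (ht x)
        | smul a s _ hs =>
          intro x
          rw [smul_eq_mul, mul_comm, mul_smul]
          exact hs _
      intro x hx
      obtain ⟨y, hy⟩ := hΘ (frobFibreProj G p e x)
      obtain ⟨y, rfl⟩ := augmentation_surjective (k := k) (V := V) W y
      rw [← frobFibreProj_symTensorSumLift, eq_comm, ← sub_eq_zero, ← map_sub,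
        frobFibreProj_eq_zero_iff] at hy
      have hz : ∀ z ∈ maxIdealFrobSym k V p e, frobComponent k V p e n z ∈ LinearMap.range Ψ := by
        intro z hz
        refine Submodule.smul_induction_on hz (fun s hs z _ => hmax s hs z) fun x y hx hy => ?_
        rw [map_add]
        exact add_mem hx hy
      have hxy := hz _ hy
      rw [map_sub, frobComponent_eq_self_iff.2 hx] at hxy
      obtain ⟨y', -, hy'⟩ := exists_symTensorSumLift_eq_frobComponent G hd n y
      rw [← hy'] at hxy
      have := add_mem hxy (LinearMap.mem_range_self Ψ y')
      rwa [← hΨ, sub_add_cancel] at this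
  intro x
  obtain ⟨N, hN⟩ := exists_sum_frobComponent x
  rw [← LinearMap.mem_range, ← hN N le_rfl]
  exact sum_mem fun m _ => hhom m _ (frobComponent_mem m x)

theorem symTensorSumLift_injective [IsAlgClosed k] [Finite J] [∀ j, FiniteDimensional k (W j)]
    (hs : Function.Surjective (symTensorSumLift (fun j => (h j).toLinearMap)))
    (hΘ : Function.Injective (DirectSum.toModule k J _
      (fun j => ((frobFibreProj G p e).comp (h j)).toLinearMap))) :
    Function.Injective (symTensorSumLift (fun j => (h j).toLinearMap)) := by
  refine LinearMap.injective_of_ker_le_smul_top SymmetricAlgebra.one_notMem_symMaxIdeal hs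
    fun x hx => ?_
  rw [← augmentation_eq_zero_iff]
  apply hΘ
  rw [← frobFibreProj_symTensorSumLift, LinearMap.mem_ker.1 hx, map_zero, map_zero]

/-- A decomposition of the fibre of `{}^e S` by homogeneous equivariant maps lifts to one of the
graded `(G, S)`-module `{}^e S`. -/
theorem exists_graded_gsEquiv [IsAlgClosed k] [Finite J] [∀ j, FiniteDimensional k (W j)]
    (hd : ∀ j w, h j w ∈ twistPiece p e (symPiece k V) (d j / (p : ℚ) ^ e))
    (hΘ : Function.Bijective (DirectSum.toModule k J _
      (fun j => ((frobFibreProj G p e).comp (h j)).toLinearMap))) :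
    ∃ φ : GSEquiv G (frobSymRep G p e) (symTensorSumRep G W ρ),
      IsGradedEquiv p e φ.toLinearEquiv (twistPiece p e (symPiece k V))
        (shiftSumPiece (fun j => symTensorPiece k V (W j)) fun j => d j / (p : ℚ) ^ e) := by
  have hs := symTensorSumLift_surjective G hd hΘ.2
  have hi := symTensorSumLift_injective G hs hΘ.1
  let Ψ := LinearEquiv.ofBijective (symTensorSumLift (fun j => (h j).toLinearMap)) ⟨hi, hs⟩
  refine ⟨⟨Ψ.symm, fun g x => ?_⟩, fun t ht x => ?_⟩
  · change Ψ.symm (frobSymRep G p e g x) = symTensorSumRep G W ρ g (Ψ.symm x)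
    obtain ⟨x, rfl⟩ := Ψ.surjective x
    rw [LinearEquiv.symm_apply_apply, LinearEquiv.symm_apply_eq]
    exact (symTensorSumLift_rep G g x).symm
  · change Ψ.symm x ∈ _ ↔ _
    obtain ⟨x, rfl⟩ := Ψ.surjective x
    rw [LinearEquiv.symm_apply_apply]
    refine ⟨symTensorSumLift_mem G hd t, fun hx => ?_⟩
    obtain ⟨z, rfl⟩ := mem_fracDegrees_iff.1 ht
    -- The components only cover degrees n / q with n natural; in negative degrees {}^e S vanishes.
    rcases lt_or_ge z 0 with hz | hz
    · have hq : (0 : ℚ) < (p : ℚ) ^ e := pow_pos (Nat.cast_pos.2 (expChar_pos k p)) e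
      rw [twistPiece_symPiece_eq_bot_of_neg (div_neg_of_neg_of_pos (Int.cast_lt_zero.2 hz) hq),
        Submodule.mem_bot, LinearEquiv.map_eq_zero_iff] at hx
      rw [hx]
      exact zero_mem _
    · lift z to ℕ using hz
      rw [Int.cast_natCast] at hx ⊢
      obtain ⟨y, hy, hyx⟩ := exists_symTensorSumLift_eq_frobComponent G hd z x
      rw [frobComponent_eq_self_iff.2
        (show symTensorSumLift (fun j => (h j).toLinearMap) x ∈ _ from hx)] at hyx
      rwa [← hi hyx]

end LiftedDecomposition

/-! ### Invariants of {}^e S and of ⨁ S ⊗ W_j -/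

section Invariants

variable {k V : Type*} [Field k] [AddCommGroup V] [Module k V]
variable (G : Subgroup (LinearMap.GeneralLinearGroup k V))

/-- The inclusion of `{}^e R` into `{}^e S`. -/
def frobInvariantIncl (p e : ℕ) :
    FrobTwist p e (invariantRing G) →+ FrobTwist p e (SymmetricAlgebra k V) :=
  ((FrobTwist.of p e (SymmetricAlgebra k V)).toAddMonoidHom.comp
    (invariantRing G).val.toAddMonoidHom).comp
      (FrobTwist.of p e (invariantRing G)).symm.toAddMonoidHom

theorem isInvariantsOf_frobInvariantIncl (p e : ℕ) [ExpChar k p] :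
    IsInvariantsOf (frobSymRep G p e) (frobInvariantIncl G p e) where
  injective _ _ h := Subtype.ext h
  map_coe_smul _ _ := rfl
  rep_apply g m := m.2 g
  exists_eq x hx := ⟨⟨x, hx⟩, rfl⟩

variable {J : Type*} {W : J → Type*} [∀ j, AddCommGroup (W j)] [∀ j, Module k (W j)]
variable (ρ : ∀ j, Representation k G (W j))

/-- The inclusion of the covariants into `⨁ S ⊗ W_j`. -/
def covariantsIncl : (⨁ j, covariants G (ρ j)) →+ ⨁ j, SymmetricAlgebra k V ⊗[k] W j :=
  DirectSum.map fun j => (covariants G (ρ j)).subtype.toAddMonoidHom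

theorem isInvariantsOf_covariantsIncl [Finite J] :
    IsInvariantsOf (symTensorSumRep G W ρ) (covariantsIncl G ρ) where
  injective x y h := DFinsupp.ext fun j => Subtype.ext congr($h j)
  map_coe_smul r x := DFinsupp.ext fun j => rfl
  rep_apply g x := DFinsupp.ext fun j => (x j).2 g
  exists_eq x hx := by
    have := Fintype.ofFinite J
    exact ⟨DFinsupp.equivFunOnFintype.symm fun j => ⟨x j, fun g => congr($(hx g) j)⟩,
      DFinsupp.ext fun j => rfl⟩

variable {N N' M M' : Type*}
  [AddCommMonoid N] [Module k N] [Module (SymmetricAlgebra k V) N]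
  [AddCommMonoid N'] [Module k N'] [Module (SymmetricAlgebra k V) N']
  [AddCommMonoid M] [Module (invariantRing G) M] [AddCommMonoid M'] [Module (invariantRing G) M']
  {σ : Representation k G N} {τ : Representation k G N'} {i : M →+ N} {i' : M' →+ N'}

-- An equivariant isomorphism restricts to invariants. The compatibility with the inclusions is kept
-- because the gradings of the invariants are induced along them.
variable {G} in
theorem GSEquiv.exists_linearEquiv_invariants (φ : GSEquiv G σ τ) (hi : IsInvariantsOf σ i)
    (hi' : IsInvariantsOf τ i') :
    ∃ f : M ≃ₗ[invariantRing G] M', ∀ m, i' (f m) = φ.toLinearEquiv (i m) := by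
  have h (m : M) : ∃ m', i' m' = φ.toLinearEquiv (i m) := hi'.exists_eq _ fun g => by
    rw [← show φ.toLinearEquiv (σ g (i m)) = τ g (φ.toLinearEquiv (i m)) from φ.map_rep g _,
      hi.rep_apply]
  choose f hf using h
  refine ⟨LinearEquiv.ofBijective
    { toFun := f
      map_add' := fun x y => hi'.injective (by rw [map_add, hf, hf, hf, map_add, map_add])
      map_smul' := fun r x => hi'.injective (by
        rw [RingHom.id_apply, hi'.map_coe_smul, hf, hf, hi.map_coe_smul, map_smul]) }
    ⟨fun x y hxy => ?_, fun y => ?_⟩, hf⟩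
  · apply hi.injective
    apply φ.toLinearEquiv.injective
    rw [← hf, ← hf]
    exact congrArg i' hxy
  · obtain ⟨m, hm⟩ := hi.exists_eq (φ.toLinearEquiv.symm (i' y)) fun g => by
      apply φ.toLinearEquiv.injective
      rw [show φ.toLinearEquiv (σ g _) = τ g (φ.toLinearEquiv _) from φ.map_rep g _,
        LinearEquiv.apply_symm_apply, hi'.rep_apply]
    refine ⟨m, hi'.injective ?_⟩
    change i' (f m) = i' y
    rw [hf, hm, LinearEquiv.apply_symm_apply]

end Invariants

end

theorem mainTheorem2 {k V : Type*} [Field k] [IsAlgClosed k] (p : ℕ) [Fact p.Prime] [CharP k p]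
    [AddCommGroup V] [Module k V] [FiniteDimensional k V]
    (G : Subgroup (LinearMap.GeneralLinearGroup k V)) [Finite G] (hpG : ¬ p ∣ Nat.card G)
    (hrefl : ∀ g ∈ G, ¬ IsPseudoReflection g)
    {n : ℕ} (W : Fin (n + 1) → Type w) [∀ i, AddCommGroup (W i)] [∀ i, Module k (W i)]
    (ρ : ∀ i, Representation k G (W i)) (hρ : IsCompleteIrreps ρ)
    (e : ℕ) (he : 1 ≤ e) (c : Fin (n + 1) → ℕ) :
    List.TFAE [
      -- (1) `R`-modules
      Nonempty (FrobTwist p e (invariantRing G) ≃ₗ[invariantRing G]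
        ⨁ j : (i : Fin (n + 1)) × Fin (c i), covariants G (ρ j.1)),
      -- (2) `(G, S)`-modules
      Nonempty (GSEquiv G (frobSymRep G p e)
        (Representation.directSum
          (fun j : (i : Fin (n + 1)) × Fin (c i) => symTensorRep G (ρ j.1)))),
      -- (3) `G`-modules
      Nonempty ((frobFibreRep G p e).Equiv
        (Representation.directSum (fun j : (i : Fin (n + 1)) × Fin (c i) => ρ j.1))),
      -- (4) graded `(G, S)`-modules
      ∃ α : (i : Fin (n + 1)) × Fin (c i) → ℚ, (∀ j, 0 ≤ α j ∧ α j ∈ fracDegrees p e) ∧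
        ∃ φ : GSEquiv G (frobSymRep G p e)
          (Representation.directSum
            (fun j : (i : Fin (n + 1)) × Fin (c i) => symTensorRep G (ρ j.1))),
          IsGradedEquiv p e φ.toLinearEquiv
            (twistPiece p e (symPiece k V))
            (shiftSumPiece (fun j => symTensorPiece k V (W j.1)) α),
      -- (5) graded `R`-modules
      ∃ α : (i : Fin (n + 1)) × Fin (c i) → ℚ, (∀ j, 0 ≤ α j ∧ α j ∈ fracDegrees p e) ∧
        ∃ φ : FrobTwist p e (invariantRing G) ≃ₗ[invariantRing G]
          ⨁ j : (i : Fin (n + 1)) × Fin (c i), covariants G (ρ j.1),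
          IsGradedEquiv p e φ (twistPiece p e (invPiece G))
            (shiftSumPiece (fun j => covPiece G (ρ j.1)) α)] := by
  have hi := isInvariantsOf_frobInvariantIncl G p e
  have hi' := isInvariantsOf_covariantsIncl G
    (fun j : (i : Fin (n + 1)) × Fin (c i) => ρ j.1)
  tfae_have 4 → 5 := by
    rintro ⟨α, hα, φ, hφ⟩
    obtain ⟨f, hf⟩ := φ.exists_linearEquiv_invariants hi hi'
    refine ⟨α, hα, f, fun t ht m => ?_⟩
    have := hφ t ht (frobInvariantIncl G p e m)
    rw [← hf] at this
    exact this
  tfae_have 5 → 1 := fun ⟨_, _, φ, _⟩ => ⟨φ⟩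
  -- This is the step that needs the absence of pseudo-reflections.
  tfae_have 1 → 2 := fun ⟨f⟩ => hi.nonempty_gsEquiv hrefl hi' (isGSModule_frobSymRep G p e)
    (isGSModule_symTensorSumRep G _) f
  tfae_have 2 → 3 := fun ⟨φ⟩ => ⟨φ.fibreEquiv⟩
  tfae_have 3 → 4 := by
    rintro ⟨θ⟩
    have := hρ.irreducible
    have hG : (Nat.card G : k) ≠ 0 := by rwa [Ne, CharP.cast_eq_zero_iff k p]
    have (i : Fin (n + 1)) : FiniteDimensional k (W i) :=
      Representation.IsIrreducible.finiteDimensional (ρ i)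
    obtain ⟨d, h, hd, hΘ⟩ := Representation.exists_homogeneous_lift hG ρ hρ.pairwise_not_iso c
      (frobComponent k V p e) (fun m g x => frobComponent_frobSymRep G m g x)
      (fun m x => frobComponent_eq_self_iff.2 (frobComponent_mem m x)) exists_sum_frobComponent
      (frobFibreProj G p e) (frobFibreProj_surjective G) θ
    -- The shift α_j is the degree in {}^e S of the homogeneous lift of the j-th summand.
    refine ⟨fun j => d j / (p : ℚ) ^ e, fun j => ⟨by positivity, ?_⟩, ?_⟩
    · exact (mem_fracDegrees_iff).2 ⟨d j, by rw [Int.cast_natCast]⟩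
    · exact exists_graded_gsEquiv G
        (fun j w => frobComponent_eq_self_iff.1 (hd j w)) hΘ
  tfae_finish
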